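/- Let $A_1$ and $A_2$ be unital C*-algebras, let $J$ be a closed two-sided ideal of $A_1$ with quotient map $q : A_1 \to A_1/J$, and let $\pi_{1,0} : A_1/J \to B(H_{1,0})$, $\pi_{1,1} : A_1 \to B(H_{1,1})$ and $\pi_2 : A_2 \to B(H_2)$ be unital $*$-representations on complex Hilbert spaces such that $\pi_{1,0}$ and $\pi_2$ are faithful and such that $\pi_1 := (\pi_{1,0}\circ q) \oplus \pi_{1,1}$ is a faithful representation of $A_1$ on $H_1 := H_{1,0}\oplus H_{1,1}$. Let $\xi_1 \in H_{1,0} \subseteq H_1$ and $\xi_2 \in H_2$ be unit vectors. For $i \in \{1,2\}$ and $n \geq 1$ let $L_{i,n} := H_{i_1}\otimes H_{i_2}\otimes\cdots\otimes H_{i_n}$ (Hilbert space tensor product), where $i_1 = i$, $i_k \in \{1,2\}$ and $i_k \neq i_{k+1}$ for all $1 \le k < n$; let $K_i := \bigoplus_{n\geq 1} L_{i,n}$ and $K := K_1\oplus K_2$ (Hilbert space direct sums). Let $S \in B(K)$ be the isometry determined by $S\eta = \xi_1\otimes\eta$ for $\eta \in L_{2,n}$ and $S\eta = \xi_2 \otimes\eta$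 for $\eta\in L_{1,n}$, and let $A_1\oplus A_2$ act on $K$ by $$(a_1\oplus a_2)(\eta_1\otimes\cdots\otimes\eta_n) = (\pi_i(a_i)\eta_1)\otimes\eta_2\otimes\cdots\otimes\eta_n \qquad (\eta_1\otimes\cdots\otimes\eta_n \in L_{i,n}).$$ Let $C^*(A_1\oplus A_2, S)\subseteq B(K)$ be the C*-algebra generated by $A_1\oplus A_2$ and $S$. Let $K_0$, $S_0 \in B(K_0)$ and $C^*((A_1/J)\oplus A_2, S_0) \subseteq B(K_0)$ be constructed in the same way from $H_{1,0}, H_2$, the representations $\pi_{1,0}, \pi_2$ and the vectors $\xi_1,\xi_2$. Regard $K_0$ as a closed subspace of $K$ through $H_{1,0}\subseteq H_1$, with orthogonal projection $P_{K_0}$. Let $\langle J\rangle$ be the closed two-sided ideal of $C^*(A_1\oplus A_2,S)$ generated by $J \subseteq A_1 \subseteq A_1\oplus A_2$. Then the compression $\pi'(T) := P_{K_0}T|_{K_0}$ restricts to a unital $*$-homomorphism $\pi' : C^*(A_1\oplus A_2,S)\to C^*((A_1/J)\oplus A_2,S_0)$, and the sequence $$0\to\langle J\rangle\to C^*(A_1\oplus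 A_2,S)\xrightarrow{\ \pi'\ } C^*((A_1/J)\oplus A_2,S_0)\to 0,$$ in which the first map is the inclusion, is exact; that is, $\pi'$ is surjective and $\ker\pi' = \langle J\rangle$. -/

import Mathlib

open scoped TensorProduct lp ENNReal

universe u

namespace ToeplitzPimsner

section Quotient

variable {A : Type*} [CStarAlgebra A]

/-- A closed two-sided ideal of a C*-algebra is self-adjoint. -/
theorem star_mem_of_isClosed (J : Ideal A) [J.IsTwoSided] (hJ : IsClosed (J : Set A))
    {x : A} (hx : x ∈ J) : star x ∈ J := by
  set a := star x * x with ha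
  have haJ : a ∈ J := J.mul_mem_left _ hx
  have hsa : IsSelfAdjoint a := IsSelfAdjoint.star_mul_self x
  let g : ℕ → ℝ → ℝ := fun n t => ((n : ℝ) + 1) ^ 2 * t / (1 + ((n : ℝ) + 1) ^ 2 * t ^ 2)
  let h : ℕ → ℝ → ℝ := fun n t => 1 / (1 + ((n : ℝ) + 1) ^ 2 * t ^ 2)
  have hpos : ∀ (n : ℕ) (t : ℝ), 0 < 1 + ((n : ℝ) + 1) ^ 2 * t ^ 2 := fun n t => by positivity
  have hgc : ∀ n, Continuous (g n) := fun n =>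
    (by fun_prop : Continuous fun t : ℝ => ((n : ℝ) + 1) ^ 2 * t).div (by fun_prop)
      fun t => (hpos n t).ne'
  have hhc : ∀ n, Continuous (h n) := fun n =>
    (by fun_prop : Continuous fun _ : ℝ => (1 : ℝ)).div (by fun_prop) fun t => (hpos n t).ne'
  have hone : ∀ n, 1 - cfc (g n) a * a = cfc (h n) a := by
    intro n
    have h1 : cfc (g n) a * a = cfc (fun t => g n t * t) a := by
      rw [cfc_mul (g n) (fun t => t) a (hgc n).continuousOn continuousOn_id, cfc_id' ℝ a]
    rw [h1, ← cfc_one ℝ a, ← cfc_sub (1 : ℝ → ℝ) (fun t => g n t * t) a continuousOn_const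
      (((hgc n).mul continuous_id : Continuous fun t => g n t * t).continuousOn)]
    refine cfc_congr fun t _ => ?_
    have := (hpos n t).ne'
    simp only [g, h, Pi.one_apply]
    field_simp
    ring
  have hbound : ∀ n : ℕ, ‖star x - cfc (g n) a * a * star x‖ ^ 2 ≤ 1 / ((n : ℝ) + 1) := by
    intro n
    have e1 : star x - cfc (g n) a * a * star x = cfc (h n) a * star x := by
      rw [← hone n, sub_mul, one_mul]
    have hs : star (cfc (h n) a) = cfc (h n) a := (cfc_predicate (h n) a : IsSelfAdjoint _)
    rw [e1, sq, ← CStarRing.norm_self_mul_star, star_mul, star_star, hs]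
    have e2 : cfc (h n) a * star x * (x * cfc (h n) a) = cfc (fun t => h n t * t * h n t) a := by
      rw [cfc_mul (fun t => h n t * t) (h n) a ((hhc n).mul continuous_id).continuousOn
        (hhc n).continuousOn, cfc_mul (h n) (fun t => t) a (hhc n).continuousOn continuousOn_id,
        cfc_id' ℝ a, ha]
      simp only [mul_assoc]
    rw [e2]
    refine norm_cfc_le (by positivity) fun t _ => ?_
    have hp := hpos n t
    have hn : (0 : ℝ) < (n : ℝ) + 1 := by positivity
    have hh0 : 0 ≤ h n t := by simp only [h]; positivity
    have hh1 : h n t ≤ 1 := by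
      simp only [h]; rw [div_le_one hp]; nlinarith [sq_nonneg (((n : ℝ) + 1) * t)]
    have ht : |t| * h n t ≤ 1 / ((n : ℝ) + 1) := by
      simp only [h]
      rw [mul_one_div, div_le_div_iff₀ hp hn]
      nlinarith [sq_nonneg (((n : ℝ) + 1) * |t| - 1), sq_abs t]
    rw [Real.norm_eq_abs, abs_mul, abs_mul, abs_of_nonneg hh0]
    calc h n t * |t| * h n t = (|t| * h n t) * h n t := by ring
      _ ≤ (|t| * h n t) * 1 := by gcongr
      _ ≤ _ := by rw [mul_one]; exact ht
  have hlim : Filter.Tendsto (fun n : ℕ => cfc (g n) a * a * star x) Filter.atTop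
      (nhds (star x)) := by
    rw [tendsto_iff_norm_sub_tendsto_zero]
    have h2 : Filter.Tendsto (fun n : ℕ => ‖star x - cfc (g n) a * a * star x‖ ^ 2)
        Filter.atTop (nhds 0) :=
      squeeze_zero (fun _ => by positivity) hbound tendsto_one_div_add_atTop_nhds_zero_nat
    have h3 := (Real.continuous_sqrt.tendsto 0).comp h2
    simpa [Function.comp_def, norm_sub_rev] using h3
  exact hJ.mem_of_tendsto hlim (Filter.Eventually.of_forall fun n =>
    J.mul_mem_right _ (J.mul_mem_left _ haJ))

variable (J : Ideal A) [J.IsTwoSided] [hJ : Fact (IsClosed (J : Set A))]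

/-- The involution of the quotient `A ⧸ J`, given by `[a]* = [a*]`. -/
noncomputable instance quotientStarRing : StarRing (A ⧸ J) where
  star := Quotient.lift (fun a => Ideal.Quotient.mk J (star a)) fun a b hab => by
    have h1 : a - b ∈ J := (Submodule.quotientRel_def J).mp hab
    refine Ideal.Quotient.eq.mpr ?_
    rw [← star_sub]
    exact star_mem_of_isClosed J hJ.out h1
  star_involutive x := by
    obtain ⟨a, rfl⟩ := Ideal.Quotient.mk_surjective x
    exact congrArg (Ideal.Quotient.mk J) (star_star a)
  star_mul x y := by
    obtain ⟨a, rfl⟩ := Ideal.Quotient.mk_surjective x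
    obtain ⟨b, rfl⟩ := Ideal.Quotient.mk_surjective y
    exact congrArg (Ideal.Quotient.mk J) (star_mul a b)
  star_add x y := by
    obtain ⟨a, rfl⟩ := Ideal.Quotient.mk_surjective x
    obtain ⟨b, rfl⟩ := Ideal.Quotient.mk_surjective y
    exact congrArg (Ideal.Quotient.mk J) (star_add a b)

/-- The canonical quotient map `A → A ⧸ J`, as a unital *-homomorphism. -/
noncomputable def quotientMap : A →⋆ₐ[ℂ] A ⧸ J where
  __ := Ideal.Quotient.mkₐ ℂ J
  map_star' _ := rfl

end Quotient

/-- A complex Hilbert space, bundled so that iterated tensor products can be formed recursively. -/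
structure HilbertSp where
  carrier : Type u
  [instGroup : NormedAddCommGroup carrier]
  [instInner : InnerProductSpace ℂ carrier]
  [instComplete : CompleteSpace carrier]

namespace HilbertSp
instance : CoeSort HilbertSp.{u} (Type u) := ⟨carrier⟩
attribute [instance] instGroup instInner instComplete

/-- A Hilbert space, bundled. -/
abbrev of (E : Type u) [NormedAddCommGroup E] [InnerProductSpace ℂ E] [CompleteSpace E] :
    HilbertSp.{u} := ⟨E⟩

/-- The Hilbert space tensor product: the completion of the algebraic tensor product. -/
noncomputable abbrev tensor (E F : HilbertSp.{u}) : HilbertSp.{u} :=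
  ⟨UniformSpace.Completion (E ⊗[ℂ] F)⟩

/-- `E ⊗ F ⊗ E ⊗ ⋯` with `n + 1` alternating factors, the first of which is `E`. -/
noncomputable def alt (E F : HilbertSp.{u}) : ℕ → HilbertSp.{u}
  | 0 => E
  | n + 1 => tensor E (alt F E n)

end HilbertSp
open HilbertSp

/-- The operator `T ⊗ 1 ⊗ ⋯ ⊗ 1` on `E ⊗ F ⊗ E ⊗ ⋯` (`n + 1` factors). -/
noncomputable def leftOp {E : HilbertSp.{u}} (F : HilbertSp.{u}) (T : E →L[ℂ] E) :
    ∀ n : ℕ, alt E F n →L[ℂ] alt E F n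
  | 0 => T
  | n + 1 => (T.rTensor (alt F E n)).completion

theorem norm_leftOp_le {E : HilbertSp.{u}} (F : HilbertSp.{u}) (T : E →L[ℂ] E) :
    ∀ n : ℕ, ‖leftOp F T n‖ ≤ ‖T‖
  | 0 => le_rfl
  | n + 1 => by
    refine ContinuousLinearMap.opNorm_le_bound _ (norm_nonneg _) fun x => ?_
    change UniformSpace.Completion (E ⊗[ℂ] alt F E n) at x
    induction x using UniformSpace.Completion.induction_on with
    | hp => exact isClosed_le (leftOp F T (n + 1)).continuous.norm (by fun_prop)
    | ih x =>
      change ‖(T.rTensor (alt F E n)).completion x‖ ≤ _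
      rw [ContinuousLinearMap.completion_apply_coe, UniformSpace.Completion.norm_coe]
      refine (ContinuousLinearMap.le_of_opNorm_le _ (ContinuousLinearMap.norm_rTensor_le _ T) x).trans
        (le_of_eq ?_)
      congr 1
      exact (UniformSpace.Completion.norm_coe x).symm

/-- `x ↦ ξ ⊗ x`, from `F ⊗ E ⊗ ⋯` (`n + 1` factors) to `E ⊗ F ⊗ E ⊗ ⋯` (`n + 2` factors). -/
noncomputable def creation {E : HilbertSp.{u}} (F : HilbertSp.{u}) (ξ : E) (n : ℕ) :
    alt F E n →L[ℂ] alt E F (n + 1) :=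
  UniformSpace.Completion.toComplL.comp (TensorProduct.mkL ℂ E (alt F E n) ξ)

theorem norm_creation_apply {E : HilbertSp.{u}} (F : HilbertSp.{u}) (ξ : E) (n : ℕ)
    (x : alt F E n) : ‖creation F ξ n x‖ = ‖ξ‖ * ‖x‖ :=
  (UniformSpace.Completion.norm_coe _).trans (TensorProduct.norm_tmul ξ x)

/-- `⨁_{n ≥ 1} (E ⊗ F ⊗ E ⊗ ⋯ with n factors)`, a Hilbert space direct sum. Component `n : ℕ`
is the summand with `n + 1` factors. -/
abbrev AltSum (E F : HilbertSp.{u}) : Type u := lp (fun n => alt E F n) 2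

/-- `T` acting on the first tensor factor of every summand. -/
noncomputable def leftOpSum {E : HilbertSp.{u}} (F : HilbertSp.{u}) (T : E →L[ℂ] E) :
    AltSum E F →L[ℂ] AltSum E F :=
  lp.mapCLM 2 (leftOp F T) (norm_nonneg T) (norm_leftOp_le F T)

/-- The components of `creationSum`. -/
noncomputable def creationSeq {E : HilbertSp.{u}} (F : HilbertSp.{u}) (ξ : E)
    (x : ∀ n, alt F E n) : ∀ n, alt E F n
  | 0 => 0
  | n + 1 => creation F ξ n (x n)

theorem hasSum_creationSeq {E F : HilbertSp.{u}} (ξ : E) (x : AltSum F E) :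
    HasSum (fun n => ‖creationSeq F ξ x n‖ ^ 2) (‖ξ‖ ^ 2 * ‖x‖ ^ 2) := by
  have h := lp.hasSum_norm (p := 2) (by norm_num) x
  simp only [ENNReal.toReal_ofNat, Real.rpow_ofNat] at h
  rw [hasSum_nat_add_iff' 1 |>.symm]
  simpa [creationSeq, norm_creation_apply, mul_pow] using! h.mul_left (‖ξ‖ ^ 2)

theorem memℓp_creationSeq {E F : HilbertSp.{u}} (ξ : E) (x : AltSum F E) :
    Memℓp (creationSeq F ξ x) 2 :=
  memℓp_gen (by simpa using (hasSum_creationSeq ξ x).summable)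

/-- `(x_n)_n ↦ (ξ ⊗ x_n)_n`, raising the number of tensor factors by one. -/
noncomputable def creationSum {E F : HilbertSp.{u}} (ξ : E) : AltSum F E →L[ℂ] AltSum E F :=
  LinearMap.mkContinuous
    { toFun := fun x => ⟨creationSeq F ξ x, memℓp_creationSeq ξ x⟩
      map_add' := fun x y => by
        ext n
        cases n with
        | zero => exact (add_zero _).symm
        | succ n => exact map_add (creation F ξ n) (x n) (y n)
      map_smul' := fun c x => by
        ext n
        cases n with
        | zero => exact (smul_zero _).symm
        | succ n => exact map_smul (creation F ξ n) c (x n) }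
    ‖ξ‖ fun x => by
      have h := lp.hasSum_norm (p := 2) (by norm_num)
        (⟨creationSeq F ξ x, memℓp_creationSeq ξ x⟩ : AltSum E F)
      simp only [ENNReal.toReal_ofNat, Real.rpow_ofNat] at h
      have h' := h.unique (hasSum_creationSeq ξ x)
      refine abs_le_of_sq_le_sq' (h'.trans (mul_pow _ _ _).symm).le (by positivity) |>.2

/-- The completion of an isometry. -/
noncomputable def completionIsometry {X Y : Type u} [NormedAddCommGroup X] [InnerProductSpace ℂ X]
    [NormedAddCommGroup Y] [InnerProductSpace ℂ Y] (f : X →ₗᵢ[ℂ] Y) :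
    UniformSpace.Completion X →ₗᵢ[ℂ] UniformSpace.Completion Y where
  toLinearMap := f.toContinuousLinearMap.completion.toLinearMap
  norm_map' x := by
    induction x using UniformSpace.Completion.induction_on with
    | hp => exact isClosed_eq f.toContinuousLinearMap.completion.continuous.norm (by fun_prop)
    | ih x =>
      change ‖f.toContinuousLinearMap.completion x‖ = _
      rw [ContinuousLinearMap.completion_apply_coe, UniformSpace.Completion.norm_coe,
        UniformSpace.Completion.norm_coe]
      exact f.norm_map x

/-- The isometry `f ⊗ g ⊗ f ⊗ ⋯` (`n + 1` factors). -/
noncomputable def altIsometry : ∀ {E F E' F' : HilbertSp.{u}}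
    (_ : E →ₗᵢ[ℂ] E') (_ : F →ₗᵢ[ℂ] F') (n : ℕ), alt E F n →ₗᵢ[ℂ] alt E' F' n
  | _, _, _, _, f, _, 0 => f
  | _, _, _, _, f, g, n + 1 => completionIsometry (TensorProduct.mapIsometry f (altIsometry g f n))

/-- The direct sum of the isometries `altIsometry f g n`. -/
noncomputable def altSumIsometry {E F E' F' : HilbertSp.{u}} (f : E →ₗᵢ[ℂ] E') (g : F →ₗᵢ[ℂ] F') :
    AltSum E F →ₗᵢ[ℂ] AltSum E' F' where
  toLinearMap := (lp.mapCLM 2 (fun n => (altIsometry f g n).toContinuousLinearMap) zero_le_one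
    fun n => (altIsometry f g n).norm_toContinuousLinearMap_le).toLinearMap
  norm_map' x := by
    have h := lp.hasSum_norm (p := 2) (by norm_num) (lp.mapCLM 2 (fun n =>
      (altIsometry f g n).toContinuousLinearMap) zero_le_one
      (fun n => (altIsometry f g n).norm_toContinuousLinearMap_le) x)
    have h' := lp.hasSum_norm (p := 2) (by norm_num) x
    simp only [ENNReal.toReal_ofNat, Real.rpow_ofNat, lp.mapCLM_apply_coe,
      LinearIsometry.coe_toContinuousLinearMap, LinearIsometry.norm_map] at h h'
    exact (pow_left_inj₀ (norm_nonneg _) (norm_nonneg _) two_ne_zero).mp (h.unique h')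

variable {A B : Type*} [Ring A] [StarRing A] [Algebra ℂ A]
  [Ring B] [StarRing B] [Algebra ℂ B]
  {H H' : Type u} [NormedAddCommGroup H] [InnerProductSpace ℂ H] [CompleteSpace H]
  [NormedAddCommGroup H'] [InnerProductSpace ℂ H'] [CompleteSpace H']

/-- The operator `f ⊕ g`, that is `(x, y) ↦ (f x, g y)`. -/
noncomputable def blockDiag {X Y : Type*} [NormedAddCommGroup X] [InnerProductSpace ℂ X]
    [NormedAddCommGroup Y] [InnerProductSpace ℂ Y] (f : X →L[ℂ] X) (g : Y →L[ℂ] Y) :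
    WithLp 2 (X × Y) →L[ℂ] WithLp 2 (X × Y) :=
  (WithLp.prodContinuousLinearEquiv 2 ℂ X Y).symm.toContinuousLinearMap.comp
    ((f.prodMap g).comp (WithLp.prodContinuousLinearEquiv 2 ℂ X Y).toContinuousLinearMap)

/-- The direct sum `π ⊕ ρ` of two representations. -/
noncomputable def directSumRep (π : A →⋆ₐ[ℂ] (H →L[ℂ] H)) (ρ : A →⋆ₐ[ℂ] (H' →L[ℂ] H')) :
    A →⋆ₐ[ℂ] (WithLp 2 (H × H') →L[ℂ] WithLp 2 (H × H')) where
  toFun a := blockDiag (π a) (ρ a)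
  map_one' := by ext x; simp [blockDiag]
  map_mul' a b := by ext x; simp [blockDiag, Prod.map]
  map_zero' := by ext x; simp [blockDiag, Prod.map]
  map_add' a b := by ext x; simp [blockDiag, Prod.map]; rfl
  commutes' r := by
    ext x; simp [blockDiag, Algebra.algebraMap_eq_smul_one, Prod.map]; rfl
  map_star' a := by
    rw [map_star, map_star, ContinuousLinearMap.star_eq_adjoint, ContinuousLinearMap.star_eq_adjoint,
      ContinuousLinearMap.star_eq_adjoint, ContinuousLinearMap.eq_adjoint_iff]
    intro x y
    simp [blockDiag, WithLp.prod_inner_apply, ContinuousLinearMap.adjoint_inner_left]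

/-- The Hilbert space `𝒦 = 𝒦₁ ⊕ 𝒦₂`, where `𝒦₁` is the direct sum of the alternating tensor
products `H ⊗ H' ⊗ H ⊗ ⋯` and `𝒦₂` that of the alternating tensor products `H' ⊗ H ⊗ H' ⊗ ⋯`
(with `n ≥ 1` factors). -/
abbrev Fock (H H' : Type u) [NormedAddCommGroup H] [InnerProductSpace ℂ H] [CompleteSpace H]
    [NormedAddCommGroup H'] [InnerProductSpace ℂ H'] [CompleteSpace H'] : Type u :=
  WithLp 2 (AltSum (.of H) (.of H') × AltSum (.of H') (.of H))

/-- The operator `S`: on `𝒦₂` it is `η ↦ ξ ⊗ η ∈ 𝒦₁`, on `𝒦₁` it is `η ↦ ξ' ⊗ η ∈ 𝒦₂`. -/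
noncomputable def shift (ξ : H) (ξ' : H') : Fock H H' →L[ℂ] Fock H H' :=
  (WithLp.prodContinuousLinearEquiv 2 ℂ _ _).symm.toContinuousLinearMap.comp
    (((creationSum (E := .of H) (F := .of H') ξ).comp (WithLp.sndL 2 ℂ _ _)).prod
      ((creationSum (E := .of H') (F := .of H) ξ').comp (WithLp.fstL 2 ℂ _ _)))

/-- The action of `A ⊕ B` on `𝒦`: `A` acts through `π` on the first tensor factor of the elements of
`𝒦₁`, and `B` acts through `ρ` on the first tensor factor of the elements of `𝒦₂`. -/
noncomputable def fockRep (π : A →⋆ₐ[ℂ] (H →L[ℂ] H)) (ρ : B →⋆ₐ[ℂ] (H' →L[ℂ] H')) (a : A × B) :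
    Fock H H' →L[ℂ] Fock H H' :=
  blockDiag (leftOpSum (E := .of H) (.of H') (π a.1)) (leftOpSum (E := .of H') (.of H) (ρ a.2))

/-- The Toeplitz-Pimsner algebra `C*(A ⊕ B, S)`: the C*-subalgebra of the bounded operators on `𝒦`
generated by `A ⊕ B` and `S`. -/
noncomputable def toeplitzAlgebra (π : A →⋆ₐ[ℂ] (H →L[ℂ] H)) (ρ : B →⋆ₐ[ℂ] (H' →L[ℂ] H'))
    (ξ : H) (ξ' : H') : StarSubalgebra ℂ (Fock H H' →L[ℂ] Fock H H') :=
  (StarAlgebra.adjoin ℂ (Set.range (fockRep π ρ) ∪ {shift ξ ξ'})).topologicalClosure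

/-- The closed two-sided ideal of `C*(A ⊕ B, S)` generated by `J ⊆ A ⊆ A ⊕ B`. -/
noncomputable def generatedIdeal (J : Ideal A) (π : A →⋆ₐ[ℂ] (H →L[ℂ] H))
    (ρ : B →⋆ₐ[ℂ] (H' →L[ℂ] H')) (ξ : H) (ξ' : H') : Ideal (toeplitzAlgebra π ρ ξ ξ') :=
  (TwoSidedIdeal.span {T : toeplitzAlgebra π ρ ξ ξ' |
    ∃ a ∈ J, (T : Fock H H' →L[ℂ] Fock H H') = fockRep π ρ (a, 0)}).asIdeal.closure

/-- The inclusion of the first summand `H → H ⊕ H'`. -/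
noncomputable def inclFst (H H' : Type u) [NormedAddCommGroup H] [InnerProductSpace ℂ H]
    [NormedAddCommGroup H'] [InnerProductSpace ℂ H'] :
    H →ₗᵢ[ℂ] WithLp 2 (H × H') where
  toFun x := WithLp.toLp 2 (x, 0)
  map_add' x y := by rw [← WithLp.toLp_add]; simp
  map_smul' c x := by rw [← WithLp.toLp_smul]; simp
  norm_map' x := by simp

/-- The inclusion `𝒦(H, H') → 𝒦(G, G')` induced by inclusions `H → G` and `H' → G'`; it maps
`η₁ ⊗ ⋯ ⊗ ηₙ` to the tensor product of the images of the `ηₖ`. -/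
noncomputable def fockIsometry {G G' : Type u} [NormedAddCommGroup G] [InnerProductSpace ℂ G]
    [CompleteSpace G] [NormedAddCommGroup G'] [InnerProductSpace ℂ G'] [CompleteSpace G']
    (f : H →ₗᵢ[ℂ] G) (g : H' →ₗᵢ[ℂ] G') : Fock H H' →ₗᵢ[ℂ] Fock G G' :=
  (altSumIsometry (E := .of H) (F := .of H') (E' := .of G) (F' := .of G') f g).withLpProdMap 2
    (altSumIsometry (E := .of H') (F := .of H) (E' := .of G') (F' := .of G) g f)

/-- The compression of an operator on `Y` to the subspace `X`, where `X` is regarded as a subspace of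
`Y` through the isometry `V`: `V*` is the orthogonal projection of `Y` onto `X`. -/
noncomputable def compression {X Y : Type*} [NormedAddCommGroup X] [InnerProductSpace ℂ X]
    [CompleteSpace X] [NormedAddCommGroup Y] [InnerProductSpace ℂ Y] [CompleteSpace Y]
    (V : X →ₗᵢ[ℂ] Y) (T : Y →L[ℂ] Y) : X →L[ℂ] X :=
  (ContinuousLinearMap.adjoint V.toContinuousLinearMap).comp (T.comp V.toContinuousLinearMap)

end ToeplitzPimsner

open ToeplitzPimsner

/-! The argument is of gauge-invariant uniqueness type. The compression to `K₀` is multiplicative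
because the coefficients, `S` and their adjoints all map `K₀` into itself. It sends generators to
generators, so its range is dense, and a *-homomorphism of C*-algebras has closed range. It kills
the generators of `⟨J⟩`, hence `⟨J⟩`. The real content is that every `x` in the kernel lies in `I =
⟨J⟩`.

The relation `S* B S ⊆ B` for `B = A₁ ⊕ A₂` makes the words `b₁S ⋯ bₖS · b · S*c₁ ⋯ S*cₗ` span a
dense *-algebra. Conjugation by the unitary grading `K` by word length is a circle action fixing `B`
and multiplying `S` by `z`. It preserves the kernel, so the Fourier coefficients `x_k` of the orbit
of `x` lie in the kernel, and it suffices to put each of them in `I`. Now `x_k* x_k` is fixed by the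
action, hence is a limit of balanced words (`k = l`), and `x_k* x_k ∈ I` implies `x_k ∈ I`. This
reduces the problem to the balanced part (`mem_of_map_eq_zero`).

The balanced part is the closure of the increasing union of *-algebras `C_0 = B`, `C_{N+1} = B +
(BS) C_N (S*B)`. Norm-controlled lifts allow one level to be treated at a time
(`mem_of_mem_closure_iUnion_core`), by induction on `N` (`mem_of_mem_closure_core`). Compression to
words of length one kills `BS` times anything and, the representations being faithful, is isometric
on `B`. Hence an element of the closure of `C_{N+1}` is `b + d` with `b ∈ B` and `d` in the closure
of the inner layer. If it lies in the kernel, the same compression on `K₀` shows `b ∈ J ⊕ 0`, so `b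
∈ I` and `d` is in the kernel. Multiplying `d` by `S*B` on the left and `BS` on the right lands in
the closure of `C_N`, so the results lie in `I` by induction. They yield `d* d d* ∈ I`, and
therefore `d ∈ I`. -/

namespace ToeplitzPimsner

open HilbertSp

/-! ### Closed ideals and ranges of *-homomorphisms of C*-algebras. -/

section CStarLemmas

/-- If `x* x` lies in a closed two-sided ideal of a C*-algebra, then so does `x`. -/
theorem mem_of_star_mul_self_mem {A : Type*} [CStarAlgebra A] (J : Ideal A) [J.IsTwoSided]
    (hJ : IsClosed (J : Set A)) {x : A} (hx : star x * x ∈ J) : x ∈ J := by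
  set a := star x * x with ha
  have hsa : IsSelfAdjoint a := IsSelfAdjoint.star_mul_self x
  -- With `m = n + 1`, `1 - g(t) t = h(t) = 1 / (1 + m² t²)`, so `g(a) a` acts as an approximate
  -- unit for `x` taken from the ideal. Indeed `‖x h(a)‖² = ‖h(a) a h(a)‖`, and `|t| h(t)² ≤ 1 / m`
  -- for every real `t`, so positivity of `a` is not needed.
  let g : ℕ → ℝ → ℝ := fun n t => ((n : ℝ) + 1) ^ 2 * t / (1 + ((n : ℝ) + 1) ^ 2 * t ^ 2)
  let h : ℕ → ℝ → ℝ := fun n t => 1 / (1 + ((n : ℝ) + 1) ^ 2 * t ^ 2)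
  have hpos : ∀ (n : ℕ) (t : ℝ), 0 < 1 + ((n : ℝ) + 1) ^ 2 * t ^ 2 := fun n t => by positivity
  have hgc : ∀ n, Continuous (g n) := fun n =>
    (by fun_prop : Continuous fun t : ℝ => ((n : ℝ) + 1) ^ 2 * t).div (by fun_prop)
      fun t => (hpos n t).ne'
  have hhc : ∀ n, Continuous (h n) := fun n =>
    (by fun_prop : Continuous fun _ : ℝ => (1 : ℝ)).div (by fun_prop) fun t => (hpos n t).ne'
  have hone : ∀ n, 1 - cfc (g n) a * a = cfc (h n) a := by
    intro n
    have h1 : cfc (g n) a * a = cfc (fun t => g n t * t) a := by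
      rw [cfc_mul (g n) (fun t => t) a (hgc n).continuousOn continuousOn_id, cfc_id' ℝ a]
    rw [h1, ← cfc_one ℝ a, ← cfc_sub (1 : ℝ → ℝ) (fun t => g n t * t) a continuousOn_const
      (((hgc n).mul continuous_id : Continuous fun t => g n t * t).continuousOn)]
    refine cfc_congr fun t _ => ?_
    have := (hpos n t).ne'
    simp only [g, h, Pi.one_apply]
    field_simp
    ring
  have hbound : ∀ n : ℕ, ‖x - x * (cfc (g n) a * a)‖ ^ 2 ≤ 1 / ((n : ℝ) + 1) := by
    intro n
    have e1 : x - x * (cfc (g n) a * a) = x * cfc (h n) a := by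
      rw [← hone n, mul_sub, mul_one]
    have hs : star (cfc (h n) a) = cfc (h n) a := (cfc_predicate (h n) a : IsSelfAdjoint _)
    rw [e1, sq, ← CStarRing.norm_star_mul_self, star_mul, hs]
    have e2 : cfc (h n) a * star x * (x * cfc (h n) a) = cfc (fun t => h n t * t * h n t) a := by
      rw [cfc_mul (fun t => h n t * t) (h n) a ((hhc n).mul continuous_id).continuousOn
        (hhc n).continuousOn, cfc_mul (h n) (fun t => t) a (hhc n).continuousOn continuousOn_id,
        cfc_id' ℝ a, ha]
      simp only [mul_assoc]
    rw [e2]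
    refine norm_cfc_le (by positivity) fun t _ => ?_
    have hp := hpos n t
    have hn : (0 : ℝ) < (n : ℝ) + 1 := by positivity
    have hh0 : 0 ≤ h n t := by simp only [h]; positivity
    have hh1 : h n t ≤ 1 := by
      simp only [h]; rw [div_le_one hp]; nlinarith [sq_nonneg (((n : ℝ) + 1) * t)]
    have ht : |t| * h n t ≤ 1 / ((n : ℝ) + 1) := by
      simp only [h]
      rw [mul_one_div, div_le_div_iff₀ hp hn]
      nlinarith [sq_nonneg (((n : ℝ) + 1) * |t| - 1), sq_abs t]
    rw [Real.norm_eq_abs, abs_mul, abs_mul, abs_of_nonneg hh0]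
    calc h n t * |t| * h n t = (|t| * h n t) * h n t := by ring
      _ ≤ (|t| * h n t) * 1 := by gcongr
      _ ≤ _ := by rw [mul_one]; exact ht
  have hlim : Filter.Tendsto (fun n : ℕ => x * (cfc (g n) a * a)) Filter.atTop (nhds x) := by
    rw [tendsto_iff_norm_sub_tendsto_zero]
    have h2 : Filter.Tendsto (fun n : ℕ => ‖x - x * (cfc (g n) a * a)‖ ^ 2)
        Filter.atTop (nhds 0) :=
      squeeze_zero (fun _ => by positivity) hbound tendsto_one_div_add_atTop_nhds_zero_nat
    have h3 := (Real.continuous_sqrt.tendsto 0).comp h2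
    simpa [Function.comp_def, norm_sub_rev] using h3
  exact hJ.mem_of_tendsto hlim (Filter.Eventually.of_forall fun n =>
    J.mul_mem_left _ (J.mul_mem_left _ hx))

variable {C D : Type*} [CStarAlgebra C] [CStarAlgebra D]

theorem starAlgHom_continuous (φ : C →⋆ₐ[ℂ] D) : Continuous φ :=
  AddMonoidHomClass.continuous_of_bound φ 1 fun x => by
    simpa using NonUnitalStarAlgHom.norm_apply_le φ x

/-- Truncate `c` to `[-r, r]`, `r = ‖φ c‖`, by functional calculus. The spectrum of `φ c` already
lies in that interval, so truncation does not change the image. -/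
theorem exists_selfAdjoint_lift (φ : C →⋆ₐ[ℂ] D) {c : C} (hc : IsSelfAdjoint c) :
    ∃ c', φ c' = φ c ∧ ‖c'‖ ≤ ‖φ c‖ := by
  have hφ := starAlgHom_continuous φ
  set r := ‖φ c‖
  let f : ℝ → ℝ := fun t => max (-r) (min r t)
  have hf : Continuous f := by fun_prop
  have hr : 0 ≤ r := norm_nonneg _
  refine ⟨cfc f c, ?_, norm_cfc_le hr fun t _ => ?_⟩
  · rw [StarAlgHomClass.map_cfc φ f c hf.continuousOn hφ hc (hc.map φ)]
    conv_rhs => rw [← cfc_id' ℝ (φ c) (hc.map φ)]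
    refine cfc_congr fun t ht => ?_
    have h1 : |t| ≤ r := by
      have := spectrum.norm_le_norm_mul_of_mem ht
      rcases subsingleton_or_nontrivial D with _ | _
      · exact absurd ht (by simp [spectrum.of_subsingleton])
      · simpa using this
    obtain ⟨h2, h3⟩ := abs_le.mp h1
    simp [f, h2, h3]
  · rw [Real.norm_eq_abs, abs_le]
    simp only [f]
    exact ⟨le_max_left _ _, max_le (by linarith) (min_le_left _ _)⟩

/-- Elements in the range of a *-homomorphism have preimages of controlled norm. -/
theorem exists_lift_norm_le (φ : C →⋆ₐ[ℂ] D) (c : C) :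
    ∃ c', φ c' = φ c ∧ ‖c'‖ ≤ 2 * ‖φ c‖ := by
  -- Real and imaginary parts are lifted separately; this is the source of the factor `2`.
  obtain ⟨a, ha, ha'⟩ := exists_selfAdjoint_lift φ (realPart c).2
  obtain ⟨b, hb, hb'⟩ := exists_selfAdjoint_lift φ (imaginaryPart c).2
  have h1 : ‖φ (realPart c : C)‖ ≤ ‖φ c‖ := by
    have : φ (realPart c : C) = (realPart (φ c) : D) := by
      simp [realPart_apply_coe, map_real_smul φ (starAlgHom_continuous φ), map_star]
    rw [this]; exact realPart.norm_le (φ c)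
  have h2 : ‖φ (imaginaryPart c : C)‖ ≤ ‖φ c‖ := by
    have : φ (imaginaryPart c : C) = (imaginaryPart (φ c) : D) := by
      simp [imaginaryPart_apply_coe, map_real_smul φ (starAlgHom_continuous φ), map_star]
    rw [this]; exact imaginaryPart.norm_le (φ c)
  refine ⟨a + Complex.I • b, ?_, ?_⟩
  · rw [map_add, map_smul, ha, hb, ← map_smul, ← map_add, realPart_add_I_smul_imaginaryPart]
  · refine (norm_add_le _ _).trans ?_
    rw [norm_smul, Complex.norm_I, one_mul]
    linarith

/-- The range of a *-homomorphism between C*-algebras is closed. -/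
theorem surjective_of_denseRange (φ : C →⋆ₐ[ℂ] D) (h : DenseRange φ) :
    Function.Surjective φ := by
  let f : NormedAddGroupHom C D :=
    { toFun := φ, map_add' := map_add φ,
      bound' := ⟨1, fun x => by simpa using NonUnitalStarAlgHom.norm_apply_le φ x⟩ }
  -- Preimages of controlled norm allow a point of the closure of the range to be lifted as a
  -- convergent series of lifts.
  have hyp : f.SurjectiveOnWith f.range 2 := by
    rintro _ ⟨c, rfl⟩
    exact exists_lift_norm_le φ c
  intro y
  obtain ⟨x, hx, -⟩ := controlled_closure_of_complete two_pos one_pos hyp y (by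
    change y ∈ closure (f.range : Set D)
    have : (f.range : Set D) = Set.range φ := by ext; rfl
    rw [this, h.closure_range]; trivial)
  exact ⟨x, hx⟩

end CStarLemmas

/-! ### Words in the coefficients, `S` and `S*`, and the balanced core. -/

section Words

variable {B T : Type*} [CStarAlgebra B] [CStarAlgebra T] (ι : B →⋆ₐ[ℂ] T) (S : T)

/-- The coefficient algebra, as a subspace of `T`. -/
noncomputable def coeffs : Submodule ℂ T := LinearMap.range ι.toAlgHom.toLinearMap

/-- The span of the elements `b S`. -/
noncomputable def creators : Submodule ℂ T := coeffs ι * Submodule.span ℂ {S}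

/-- The span of the elements `S* b`. -/
noncomputable def annihilators : Submodule ℂ T := Submodule.span ℂ {star S} * coeffs ι

/-- The span of the words `b₁ S ⋯ bₖ S b S* c₁ ⋯ S* cₗ` with `k` creators and `l` annihilators. -/
noncomputable def words (k l : ℕ) : Submodule ℂ T :=
  creators ι S ^ k * coeffs ι * annihilators ι S ^ l

/-- The span of the words with equally many, but at most `N`, creators and annihilators. -/
noncomputable def core : ℕ → Submodule ℂ T
  | 0 => coeffs ι
  | N + 1 => coeffs ι ⊔ creators ι S * core N * annihilators ι S

variable {ι S}

theorem map_mem_coeffs (b : B) : ι b ∈ coeffs ι := ⟨b, rfl⟩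

theorem coeffs_mul_self : coeffs ι * coeffs ι ≤ coeffs ι :=
  Submodule.mul_le.mpr fun _ ⟨a, ha⟩ _ ⟨b, hb⟩ => ⟨a * b, by rw [← ha, ← hb]; exact map_mul ι a b⟩

theorem one_le_coeffs : 1 ≤ coeffs ι :=
  Submodule.one_le.mpr ⟨1, map_one ι⟩

theorem star_mem_coeffs {x : T} (hx : x ∈ coeffs ι) : star x ∈ coeffs ι := by
  obtain ⟨b, rfl⟩ := hx
  exact ⟨star b, map_star ι b⟩

theorem self_mem_creators : S ∈ creators ι S := by
  simpa [creators] using Submodule.mul_mem_mul (map_mem_coeffs (ι := ι) 1)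
    (Submodule.mem_span_singleton_self (R := ℂ) S)

theorem star_mem_annihilators {x : T} (hx : x ∈ creators ι S) : star x ∈ annihilators ι S := by
  induction hx using Submodule.mul_induction_on' with
  | mem_mul_mem m hm n hn =>
    obtain ⟨c, rfl⟩ := Submodule.mem_span_singleton.mp hn
    rw [star_mul, star_smul]
    exact Submodule.mul_mem_mul (Submodule.smul_mem _ _ (Submodule.mem_span_singleton_self _))
      (star_mem_coeffs hm)
  | add x _ y _ hx hy => rw [star_add]; exact add_mem hx hy

theorem star_mem_creators {x : T} (hx : x ∈ annihilators ι S) : star x ∈ creators ι S := by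
  induction hx using Submodule.mul_induction_on' with
  | mem_mul_mem m hm n hn =>
    obtain ⟨c, rfl⟩ := Submodule.mem_span_singleton.mp hm
    rw [star_mul, star_smul, star_star]
    exact Submodule.mul_mem_mul (star_mem_coeffs hn)
      (Submodule.smul_mem _ _ (Submodule.mem_span_singleton_self _))
  | add x _ y _ hx hy => rw [star_add]; exact add_mem hx hy

theorem coeffs_mul_creators : coeffs ι * creators ι S ≤ creators ι S := by
  rw [creators, ← mul_assoc]; exact mul_le_mul_left coeffs_mul_self _

theorem annihilators_mul_coeffs : annihilators ι S * coeffs ι ≤ annihilators ι S := by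
  rw [annihilators, mul_assoc]; exact mul_le_mul_right coeffs_mul_self _

/-- The hypothesis `S* B S ⊆ B` enters all the word calculus through this cancellation: `S*B · BS ⊆
S*BS ⊆ B`. -/
theorem annihilators_mul_creators (hS : ∀ b, ∃ b', star S * ι b * S = ι b') :
    annihilators ι S * creators ι S ≤ coeffs ι := by
  have h : Submodule.span ℂ {star S} * coeffs ι * Submodule.span ℂ {S} ≤ coeffs ι := by
    rw [Submodule.mul_le]
    intro m hm n hn
    obtain ⟨c, rfl⟩ := Submodule.mem_span_singleton.mp hn
    rw [mul_smul_comm]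
    refine Submodule.smul_mem _ _ ?_
    induction hm using Submodule.mul_induction_on' with
    | mem_mul_mem m hm n hn =>
      obtain ⟨c, rfl⟩ := Submodule.mem_span_singleton.mp hm
      obtain ⟨b, rfl⟩ := hn
      obtain ⟨b', hb'⟩ := hS b
      rw [smul_mul_assoc, smul_mul_assoc]
      exact Submodule.smul_mem _ _ ⟨b', hb'.symm⟩
    | add x _ y _ hx hy => rw [add_mul]; exact add_mem hx hy
  calc annihilators ι S * creators ι S
      = Submodule.span ℂ {star S} * (coeffs ι * coeffs ι) * Submodule.span ℂ {S} := by
        simp only [annihilators, creators, mul_assoc]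
    _ ≤ Submodule.span ℂ {star S} * coeffs ι * Submodule.span ℂ {S} := by
        gcongr; exact coeffs_mul_self
    _ ≤ _ := h

theorem coeffs_le_core : ∀ N, coeffs ι ≤ core ι S N
  | 0 => le_rfl
  | _ + 1 => le_sup_left

theorem core_mono : Monotone (core ι S) :=
  monotone_nat_of_le_succ fun N => by
    induction N with
    | zero => exact le_sup_left
    | succ N ih => exact sup_le_sup le_rfl (mul_le_mul_left (mul_le_mul_right ih _) _)

/-- In a product of two inner layers the annihilators of the first meet the creators of the second:
`XCY · XCY = X (C (YX) C) Y`, and `YX` collapses into the coefficients. -/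
theorem core_mul_self (hS : ∀ b, ∃ b', star S * ι b * S = ι b') :
    ∀ N, core ι S N * core ι S N ≤ core ι S N
  | 0 => coeffs_mul_self
  | N + 1 => by
    have ih := core_mul_self hS N
    set X := creators ι S
    set Y := annihilators ι S
    set C := core ι S N
    have h1 : coeffs ι * (X * C * Y) ≤ X * C * Y := by
      rw [← mul_assoc, ← mul_assoc]; gcongr; exact coeffs_mul_creators
    have h2 : X * C * Y * coeffs ι ≤ X * C * Y := by
      rw [mul_assoc (X * C)]; gcongr; exact annihilators_mul_coeffs
    have h3 : X * C * Y * (X * C * Y) ≤ X * C * Y := calc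
      X * C * Y * (X * C * Y) = X * (C * (Y * X) * C) * Y := by simp only [mul_assoc]
      _ ≤ X * (C * C * C) * Y := by
        gcongr; exact (annihilators_mul_creators hS).trans (coeffs_le_core N)
      _ ≤ X * C * Y := by
        gcongr; exact (mul_le_mul_left ih _).trans ih
    change (coeffs ι ⊔ X * C * Y) * (coeffs ι ⊔ X * C * Y) ≤ coeffs ι ⊔ X * C * Y
    rw [Submodule.sup_mul, Submodule.mul_sup, Submodule.mul_sup]
    exact sup_le (sup_le (coeffs_mul_self.trans le_sup_left) (h1.trans le_sup_right))
      (sup_le (h2.trans le_sup_right) (h3.trans le_sup_right))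

theorem star_mem_core : ∀ (N : ℕ) {x : T}, x ∈ core ι S N → star x ∈ core ι S N
  | 0, _, hx => star_mem_coeffs hx
  | N + 1, x, hx => by
    obtain ⟨y, hy, z, hz, rfl⟩ := Submodule.mem_sup.mp hx
    rw [star_add]
    refine Submodule.add_mem_sup (star_mem_coeffs hy) ?_
    clear hx
    induction hz using Submodule.mul_induction_on' with
    | mem_mul_mem m hm n hn =>
      rw [star_mul]
      have hn' := star_mem_creators hn
      induction hm using Submodule.mul_induction_on' with
      | mem_mul_mem m hm p hp =>
        rw [star_mul, ← mul_assoc]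
        exact Submodule.mul_mem_mul (Submodule.mul_mem_mul hn' (star_mem_core N hp))
          (star_mem_annihilators hm)
      | add x _ y _ hx hy => rw [star_add, mul_add]; exact add_mem hx hy
    | add x _ y _ hx hy => rw [star_add]; exact add_mem hx hy

/-- The *-subalgebra underlying `core`. -/
noncomputable def coreSubalgebra (hS : ∀ b, ∃ b', star S * ι b * S = ι b') (N : ℕ) :
    StarSubalgebra ℂ T where
  carrier := core ι S N
  mul_mem' ha hb := core_mul_self hS N (Submodule.mul_mem_mul ha hb)
  add_mem' ha hb := add_mem ha hb
  algebraMap_mem' r := by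
    rw [Algebra.algebraMap_eq_smul_one]
    exact Submodule.smul_mem _ _ (coeffs_le_core N ⟨1, map_one ι⟩)
  star_mem' ha := star_mem_core N ha

theorem words_self_le_core (k : ℕ) : words ι S k k ≤ core ι S k := by
  induction k with
  | zero => simp [words, core]
  | succ k ih => calc
      words ι S (k + 1) (k + 1) = creators ι S * words ι S k k * annihilators ι S := by
        rw [words, words, pow_succ', pow_succ]; simp only [mul_assoc]
      _ ≤ creators ι S * core ι S k * annihilators ι S := by gcongr
      _ ≤ _ := le_sup_right

/-- A coefficient on the left is absorbed by the first creator, and `1` serves as the coefficient on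
the right. For `m = 0` there is no creator, and the coefficient itself stays. -/
theorem coeffs_mul_creators_pow (m : ℕ) :
    coeffs ι * creators ι S ^ m ≤ creators ι S ^ m * coeffs ι := by
  cases m with
  | zero => simp
  | succ m => calc
      coeffs ι * creators ι S ^ (m + 1) = coeffs ι * creators ι S * creators ι S ^ m * 1 := by
        rw [pow_succ', mul_one, mul_assoc]
      _ ≤ creators ι S * creators ι S ^ m * coeffs ι := by
        gcongr
        · exact coeffs_mul_creators
        · exact one_le_coeffs
      _ = _ := by rw [pow_succ']

theorem annihilators_pow_mul_coeffs (l : ℕ) :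
    annihilators ι S ^ l * coeffs ι ≤ coeffs ι * annihilators ι S ^ l := by
  cases l with
  | zero => simp
  | succ l => calc
      annihilators ι S ^ (l + 1) * coeffs ι
          = 1 * (annihilators ι S ^ l * (annihilators ι S * coeffs ι)) := by
        rw [pow_succ, one_mul, mul_assoc]
      _ ≤ coeffs ι * (annihilators ι S ^ l * annihilators ι S) := by
        gcongr
        · exact one_le_coeffs
        · exact annihilators_mul_coeffs
      _ = _ := by rw [pow_succ]

/-- Adjacent annihilator-creator pairs cancel until one kind is exhausted. The subtractions are
truncated, so at most one of `m - l` and `l - m` survives. -/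
theorem annihilators_pow_mul_creators_pow (hS : ∀ b, ∃ b', star S * ι b * S = ι b') (l : ℕ) :
    ∀ m, annihilators ι S ^ l * coeffs ι * creators ι S ^ m ≤ words ι S (m - l) (l - m) := by
  induction l with
  | zero => intro m; simpa [words] using coeffs_mul_creators_pow m
  | succ l ih =>
    intro m
    cases m with
    | zero => simpa [words] using annihilators_pow_mul_coeffs (l + 1)
    | succ m =>
      rw [Nat.add_sub_add_right, Nat.add_sub_add_right]
      refine le_trans ?_ (ih m)
      calc annihilators ι S ^ (l + 1) * coeffs ι * creators ι S ^ (m + 1)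
          = annihilators ι S ^ l * (annihilators ι S * coeffs ι * creators ι S) *
            creators ι S ^ m := by rw [pow_succ, pow_succ']; simp only [mul_assoc]
        _ ≤ annihilators ι S ^ l * coeffs ι * creators ι S ^ m := by
          gcongr
          exact (mul_le_mul_left annihilators_mul_coeffs _).trans (annihilators_mul_creators hS)

theorem words_mul_words (hS : ∀ b, ∃ b', star S * ι b * S = ι b') (k l m n : ℕ) :
    words ι S k l * words ι S m n ≤ words ι S (k + (m - l)) (l - m + n) := by
  set X := creators ι S
  set Y := annihilators ι S
  calc words ι S k l * words ι S m n
      = X ^ k * (coeffs ι * (Y ^ l * X ^ m) * coeffs ι) * Y ^ n := by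
        simp only [words, mul_assoc, X, Y]
    _ ≤ X ^ k * (X ^ (m - l) * coeffs ι * Y ^ (l - m)) * Y ^ n := by
        rw [mul_assoc (X ^ k), mul_assoc (X ^ k)]
        refine mul_le_mul_right (mul_le_mul_left ?_ _) _
        calc coeffs ι * (Y ^ l * X ^ m) * coeffs ι
            ≤ coeffs ι * (Y ^ l * coeffs ι * X ^ m) * coeffs ι := by
              gcongr
              calc Y ^ l = Y ^ l * 1 := (mul_one _).symm
                _ ≤ _ := by gcongr; exact one_le_coeffs
          _ ≤ coeffs ι * (X ^ (m - l) * coeffs ι * Y ^ (l - m)) * coeffs ι := by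
              exact mul_le_mul_left (mul_le_mul_right (annihilators_pow_mul_creators_pow hS l m) _) _
          _ = coeffs ι * X ^ (m - l) * coeffs ι * (Y ^ (l - m) * coeffs ι) := by
              simp only [mul_assoc]
          _ ≤ X ^ (m - l) * coeffs ι * coeffs ι * (coeffs ι * Y ^ (l - m)) := by
              exact mul_le_mul' (mul_le_mul_left (coeffs_mul_creators_pow _) _)
                (annihilators_pow_mul_coeffs _)
          _ = X ^ (m - l) * (coeffs ι * coeffs ι * coeffs ι) * Y ^ (l - m) := by
              simp only [mul_assoc]
          _ ≤ X ^ (m - l) * coeffs ι * Y ^ (l - m) := by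
              gcongr; exact (mul_le_mul_left coeffs_mul_self _).trans coeffs_mul_self
    _ = _ := by rw [words, pow_add, pow_add]; simp only [mul_assoc, X, Y]

variable (ι S) in
/-- The span of all words. -/
noncomputable def allWords : Submodule ℂ T := ⨆ p : ℕ × ℕ, words ι S p.1 p.2

theorem words_le_allWords (k l : ℕ) : words ι S k l ≤ allWords ι S :=
  le_iSup (fun p : ℕ × ℕ => words ι S p.1 p.2) (k, l)

theorem allWords_mul_self (hS : ∀ b, ∃ b', star S * ι b * S = ι b') :
    allWords ι S * allWords ι S ≤ allWords ι S := by
  conv_lhs => rw [allWords]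
  rw [Submodule.iSup_mul]
  refine iSup_le fun p => ?_
  rw [Submodule.mul_iSup]
  exact iSup_le fun q => (words_mul_words hS _ _ _ _).trans (words_le_allWords _ _)

theorem adjoin_le_allWords (hS : ∀ b, ∃ b', star S * ι b * S = ι b') {x : T}
    (hx : x ∈ StarAlgebra.adjoin ℂ (Set.range ι ∪ {S})) : x ∈ allWords ι S := by
  have hB : ∀ b, ι b ∈ allWords ι S := fun b =>
    words_le_allWords 0 0 (by simpa [words] using map_mem_coeffs b)
  -- Viewed as the plain algebra generated by the generators and their adjoints, the *-algebra needs
  -- only closure of `allWords` under products, not under adjoints.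
  rw [← StarSubalgebra.mem_toSubalgebra, StarAlgebra.adjoin_toSubalgebra] at hx
  induction hx using Algebra.adjoin_induction with
  | mem x hx =>
    rcases hx with (⟨b, rfl⟩ | rfl) | hx
    · exact hB b
    · refine words_le_allWords 1 0 ?_
      simpa [words] using Submodule.mul_mem_mul (self_mem_creators (ι := ι) (S := x))
        (map_mem_coeffs (ι := ι) 1)
    · rcases Set.mem_star.mp hx with ⟨b, hb⟩ | hb
      · rw [← star_star x, ← hb, ← map_star]; exact hB _
      · refine words_le_allWords 0 1 ?_
        rw [← star_star x, Set.mem_singleton_iff.mp hb]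
        simpa [words] using Submodule.mul_mem_mul (map_mem_coeffs (ι := ι) 1)
          (star_mem_annihilators (self_mem_creators (ι := ι) (S := S)))
  | algebraMap r => rw [← AlgHomClass.commutes ι]; exact hB _
  | add x y _ _ hx hy => exact add_mem hx hy
  | mul x y _ _ hx hy => exact allWords_mul_self hS (Submodule.mul_mem_mul hx hy)

end Words

/-! ### The kernel of a *-homomorphism on the core. -/

section CoreKernel

variable {B T T₀ Z : Type*} [CStarAlgebra B] [CStarAlgebra T] [CStarAlgebra T₀]
  [NormedAddCommGroup Z] [NormedSpace ℂ Z] {ι : B →⋆ₐ[ℂ] T} {S : T}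

/-- Here `ε` is modelled on compression to words of length one, which sees nothing in the range of a
creator. -/
theorem map_creators_mul_eq_zero {ε : T →L[ℂ] Z} (hε : ∀ b t, ε (ι b * S * t) = 0) {x : T}
    (hx : x ∈ creators ι S) (t : T) : ε (x * t) = 0 := by
  induction hx using Submodule.mul_induction_on' with
  | mem_mul_mem m hm n hn =>
    obtain ⟨c, rfl⟩ := Submodule.mem_span_singleton.mp hn
    obtain ⟨b, rfl⟩ := hm
    rw [mul_smul_comm, smul_mul_assoc, map_smul]
    exact (congrArg _ (hε b t)).trans (smul_zero c)
  | add x _ y _ hx hy => rw [add_mul, map_add, hx, hy, add_zero]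

theorem map_sandwich_eq_zero {ε : T →L[ℂ] Z} (hε : ∀ b t, ε (ι b * S * t) = 0)
    {P Q : Submodule ℂ T} {x : T} (hx : x ∈ creators ι S * P * Q) : ε x = 0 := by
  rw [mul_assoc] at hx
  induction hx using Submodule.mul_induction_on' with
  | mem_mul_mem m hm n hn => exact map_creators_mul_eq_zero hε hm n
  | add x _ y _ hx hy => rw [map_add, hx, hy, add_zero]

/-- If `ε` is isometric on the coefficients and vanishes on `D`, then the closure of
`coeffs ι + D` is `coeffs ι + closure D`. -/
theorem exists_sub_mem_closure {ε : T →L[ℂ] Z} (hεn : ∀ b, ‖ε (ι b)‖ = ‖b‖) {D : Submodule ℂ T}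
    (hD : ∀ d ∈ D, ε d = 0) {x : T} (hx : x ∈ closure ((coeffs ι ⊔ D : Submodule ℂ T) : Set T)) :
    ∃ b, x - ι b ∈ closure (D : Set T) := by
  obtain ⟨u, hu, hux⟩ := mem_closure_iff_seq_limit.mp hx
  have hu' : ∀ n, ∃ b, u n - ι b ∈ D := fun n => by
    obtain ⟨_, ⟨b, rfl⟩, d, hd, h⟩ := Submodule.mem_sup.mp (hu n)
    exact ⟨b, by rw [← h]; simpa using! hd⟩
  choose b hb using hu'
  have he : ∀ n, ε (u n) = ε (ι (b n)) := fun n => by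
    have := hD _ (hb n)
    rwa [map_sub, sub_eq_zero] at this
  -- The values `ε (u n) = ε (ι (b n))` converge and `ε` is isometric on coefficients, so the
  -- coefficient parts of the approximants converge by themselves.
  have hc : CauchySeq b := by
    have h1 : CauchySeq fun n => ε (u n) := ((ε.continuous.tendsto x).comp hux).cauchySeq
    rw [Metric.cauchySeq_iff] at h1 ⊢
    intro δ hδ
    obtain ⟨N, hN⟩ := h1 δ hδ
    refine ⟨N, fun m hm n hn => ?_⟩
    have := hN m hm n hn
    rwa [he, he, dist_eq_norm, ← map_sub, ← map_sub, hεn, ← dist_eq_norm] at this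
  obtain ⟨b₀, hb₀⟩ := cauchySeq_tendsto_of_complete hc
  exact ⟨b₀, mem_closure_of_tendsto (hux.sub (((starAlgHom_continuous ι).tendsto b₀).comp hb₀))
    (Filter.Eventually.of_forall hb)⟩

/-- The descent of the induction: an annihilator on the left and a creator on the right strip the
outer layer, lowering the level from `N + 1` to `N`. -/
theorem mul_mul_mem_closure_core (hS : ∀ b, ∃ b', star S * ι b * S = ι b') {N : ℕ} {d : T}
    (hd : d ∈ closure ((creators ι S * core ι S N * annihilators ι S : Submodule ℂ T) : Set T))
    {x y : T} (hx : x ∈ annihilators ι S) (hy : y ∈ creators ι S) :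
    x * d * y ∈ closure (core ι S N : Set T) := by
  refine map_mem_closure (f := fun t => x * t * y) (by fun_prop) hd fun t ht => ?_
  have h : annihilators ι S * (creators ι S * core ι S N * annihilators ι S) * creators ι S
      ≤ core ι S N := calc
    _ = annihilators ι S * creators ι S * core ι S N * (annihilators ι S * creators ι S) := by
      simp only [mul_assoc]
    _ ≤ core ι S N * core ι S N * core ι S N := by
      gcongr <;> exact (annihilators_mul_creators hS).trans (coeffs_le_core N)
    _ ≤ _ := (mul_le_mul_left (core_mul_self hS N) _).trans (core_mul_self hS N)
  exact h (Submodule.mul_mem_mul (Submodule.mul_mem_mul hx ht) hy)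

/-- Since `p` begins with a creator and `q` ends with an annihilator, `p*` ends with an annihilator
and `q*` begins with a creator. Thus `d` is flanked exactly as in `h`, and the remaining factors are
absorbed by the ideal. -/
theorem star_mul_mul_star_mem {I : Ideal T} [I.IsTwoSided] {P : Submodule ℂ T} {d : T}
    (h : ∀ x ∈ annihilators ι S, ∀ y ∈ creators ι S, x * d * y ∈ I) {p q : T}
    (hp : p ∈ creators ι S * P * annihilators ι S)
    (hq : q ∈ creators ι S * P * annihilators ι S) : star p * d * star q ∈ I := by
  rw [mul_assoc] at hp
  induction hp using Submodule.mul_induction_on' with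
  | mem_mul_mem x hx z hz =>
    induction hq using Submodule.mul_induction_on' with
    | mem_mul_mem w hw y hy =>
      have := I.mul_mem_left (star z) (I.mul_mem_right (star w)
        (h _ (star_mem_annihilators hx) _ (star_mem_creators hy)))
      simpa only [star_mul, mul_assoc] using this
    | add x _ y _ hx hy => rw [star_add, mul_add]; exact add_mem hx hy
  | add x _ y _ hx hy => rw [star_add, add_mul, add_mul]; exact add_mem hx hy

/-- Two square roots: `(d*d)*(d*d) = (d* d d*) d ∈ I` gives `d*d ∈ I`, which gives `d ∈ I`. -/
theorem mem_of_star_mul_mul_star_mem {I : Ideal T} [I.IsTwoSided] (hI : IsClosed (I : Set T))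
    {d : T} (h : star d * d * star d ∈ I) : d ∈ I := by
  refine mem_of_star_mul_self_mem I hI (mem_of_star_mul_self_mem I hI ?_)
  rw [star_mul, star_star, ← mul_assoc]
  exact I.mul_mem_right _ h

variable {Z' : Type*} [NormedAddCommGroup Z'] [NormedSpace ℂ Z']

/-- The two functionals have separate roles. `ε` is isometric on coefficients and splits `b + d` in
the closure; `ε'` vanishes on `ker φ` and decides whether `ι b` lies in `I`. -/
theorem mem_of_mem_closure_core (hS : ∀ b, ∃ b', star S * ι b * S = ι b')
    (φ : T →⋆ₐ[ℂ] T₀) {I : Ideal T} [I.IsTwoSided] (hI : IsClosed (I : Set T))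
    (hIφ : ∀ x ∈ I, φ x = 0)
    {ε : T →L[ℂ] Z} (hε : ∀ b t, ε (ι b * S * t) = 0) (hεn : ∀ b, ‖ε (ι b)‖ = ‖b‖)
    {ε' : T →L[ℂ] Z'} (hε' : ∀ b t, ε' (ι b * S * t) = 0) (hεφ : ∀ x, φ x = 0 → ε' x = 0)
    (hεI : ∀ b, ε' (ι b) = 0 → ι b ∈ I) (N : ℕ) :
    ∀ x ∈ closure (core ι S N : Set T), φ x = 0 → x ∈ I := by
  -- Splitting off the coefficient: for `x = ι b + d` in `ker φ`, `ε'` kills `x` and `d`, hence `ι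
  -- b`. So `ι b ∈ I`, and `d` is again in `ker φ`.
  have key : ∀ (D : Submodule ℂ T), (∀ d ∈ D, ε d = 0) → (∀ d ∈ D, ε' d = 0) →
      (∀ d ∈ closure (D : Set T), φ d = 0 → d ∈ I) →
      ∀ x ∈ closure ((coeffs ι ⊔ D : Submodule ℂ T) : Set T), φ x = 0 → x ∈ I := by
    intro D hD hD' ih x hx hφx
    obtain ⟨b, hb⟩ := exists_sub_mem_closure hεn hD hx
    have h0 : ε' (x - ι b) = 0 :=
      closure_minimal (t := {t | ε' t = 0}) (fun d hd => hD' d hd)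
        (isClosed_singleton.preimage ε'.continuous) hb
    have hbI : ι b ∈ I := hεI b (by rw [map_sub, hεφ x hφx, zero_sub, neg_eq_zero] at h0; exact h0)
    have := ih _ hb (by rw [map_sub, hφx, hIφ _ hbI, sub_zero])
    simpa using I.add_mem this hbI
  induction N with
  | zero =>
    have := key ⊥ (by simp) (by simp) (by
      rintro d hd -
      have : d = 0 := by simpa using hd
      rw [this]; exact I.zero_mem)
    simpa [core] using this
  | succ N ih =>
    refine key _ (fun d hd => map_sandwich_eq_zero hε hd) (fun d hd => map_sandwich_eq_zero hε' hd) ?_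
    intro d hd hφd
    -- Both outer factors `d*` are approximated by adjoints of elements of the inner layer; the
    -- middle `d` stays fixed.
    refine mem_of_star_mul_mul_star_mem hI ?_
    have h1 : ∀ x ∈ annihilators ι S, ∀ y ∈ creators ι S, x * d * y ∈ I := fun x hx y hy =>
      ih _ (mul_mul_mem_closure_core hS hd hx hy) (by simp [hφd])
    rw [← SetLike.mem_coe, ← hI.closure_eq]
    exact map_mem_closure₂ (f := fun p q => star p * d * star q) (by fun_prop) hd hd
      fun p hp q hq => star_mul_mul_star_mem h1 hp hq

/-- An approximant `y` of `x` at a finite level need not be in `ker φ`, but `‖φ y‖ ≤ ‖x - y‖`.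
Correct it by a lift `c` of `φ y` in the same closed level with `‖c‖ ≤ 2 ‖φ y‖`. Then `y - c ∈ ker
φ` and the total error is at most `3 ‖x - y‖`, whence `δ / 3`. -/
theorem mem_of_mem_closure_iUnion_core (hS : ∀ b, ∃ b', star S * ι b * S = ι b')
    (φ : T →⋆ₐ[ℂ] T₀) {I : Ideal T} (hI : IsClosed (I : Set T))
    (hcore : ∀ N, ∀ x ∈ closure (core ι S N : Set T), φ x = 0 → x ∈ I) {x : T}
    (hx : x ∈ closure (⋃ N, (core ι S N : Set T))) (hφ : φ x = 0) : x ∈ I := by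
  rw [← SetLike.mem_coe, ← hI.closure_eq]
  refine Metric.mem_closure_iff.mpr fun δ hδ => ?_
  obtain ⟨y, hy, hxy⟩ := Metric.mem_closure_iff.mp hx (δ / 3) (by positivity)
  obtain ⟨N, hN⟩ := Set.mem_iUnion.mp hy
  let C := (coreSubalgebra hS N).topologicalClosure
  -- Closedness makes `C` a C*-algebra, as the lifting lemma requires.
  have hC : IsClosed (C : Set T) := (coreSubalgebra hS N).isClosed_topologicalClosure
  have hyC : y ∈ C := (coreSubalgebra hS N).le_topologicalClosure hN
  obtain ⟨c, hc, hcn⟩ := exists_lift_norm_le (φ.comp C.subtype) ⟨y, hyC⟩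
  replace hc : φ c = φ y := hc
  replace hcn : ‖(c : T)‖ ≤ 2 * ‖φ y‖ := hcn
  have hφy : ‖φ y‖ ≤ ‖x - y‖ := by
    have := NonUnitalStarAlgHom.norm_apply_le φ (y - x)
    rwa [map_sub, hφ, sub_zero, norm_sub_rev] at this
  refine ⟨y - c, hcore N _ (sub_mem hyC c.2) (by rw [map_sub, hc, sub_self]), ?_⟩
  rw [dist_eq_norm] at hxy ⊢
  calc ‖x - (y - c)‖ = ‖(x - y) + c‖ := by congr 1; abel
    _ ≤ ‖x - y‖ + ‖(c : T)‖ := norm_add_le _ _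
    _ < δ := by linarith

end CoreKernel

/-! ### Circle actions, Fourier coefficients and reduction to the core. -/

section Gauge

open MeasureTheory AddCircle

theorem integrable_of_continuous {E : Type*} [NormedAddCommGroup E] {f : UnitAddCircle → E}
    (hf : Continuous f) : Integrable f haarAddCircle :=
  hf.integrable_of_hasCompactSupport (HasCompactSupport.of_compactSpace f)

theorem fourierCoeff_clm {E F : Type*} [NormedAddCommGroup E] [NormedSpace ℂ E] [CompleteSpace E]
    [NormedAddCommGroup F] [NormedSpace ℂ F] [CompleteSpace F] (L : E →L[ℂ] F)
    {f : UnitAddCircle → E} (hf : Continuous f) (k : ℤ) :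
    fourierCoeff (fun t => L (f t)) k = L (fourierCoeff f k) := by
  refine Eq.trans ?_
    (L.integral_comp_comm (integrable_of_continuous ((fourier (-k)).continuous.smul hf)))
  simp only [map_smul]
  rfl

/-- A continuous function on the circle all of whose Fourier coefficients lie in a closed subspace
takes values in that subspace. -/
theorem apply_mem_of_fourierCoeff_mem {E : Type*} [NormedAddCommGroup E] [NormedSpace ℂ E]
    [CompleteSpace E] {P : Submodule ℂ E} (hP : IsClosed (P : Set E)) {f : UnitAddCircle → E}
    (hf : Continuous f) (h : ∀ k, fourierCoeff f k ∈ P) (t : UnitAddCircle) : f t ∈ P := by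
  have := hP
  by_contra hne
  have hne' : (Submodule.Quotient.mk (f t) : E ⧸ P) ≠ 0 := fun h0 =>
    hne ((Submodule.Quotient.mk_eq_zero P).mp h0)
  -- A functional on `E ⧸ P` separating `f t` from `P` gives a continuous scalar function with all
  -- Fourier coefficients zero. Its Fourier series is trivially summable, hence converges pointwise
  -- to it, so it vanishes.
  obtain ⟨l, hl⟩ := SeparatingDual.exists_ne_zero (R := ℂ) hne'
  let L : E →L[ℂ] ℂ := l.comp ⟨P.mkQ, continuous_quotient_mk'⟩
  let g : C(UnitAddCircle, ℂ) := ⟨fun t => L (f t), L.continuous.comp hf⟩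
  have hg : fourierCoeff g = 0 := by
    ext k
    refine (fourierCoeff_clm L hf k).trans ?_
    change l (Submodule.Quotient.mk (fourierCoeff f k)) = 0
    rw [(Submodule.Quotient.mk_eq_zero P).mpr (h k), map_zero]
  have hs := has_pointwise_sum_fourier_series_of_summable (f := g) (by rw [hg]; exact summable_zero) t
  simp only [hg, Pi.zero_apply, zero_smul] at hs
  exact hl (hs.unique hasSum_zero)

variable {B T T₀ : Type*} [CStarAlgebra B] [CStarAlgebra T] [CStarAlgebra T₀]
  {ι : B →⋆ₐ[ℂ] T} {S : T} {γ : Circle → T →⋆ₐ[ℂ] T}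

theorem eigenspace_mul_le (ψ : T →⋆ₐ[ℂ] T) (c d : ℂ) :
    Module.End.eigenspace (ψ.toAlgHom.toLinearMap : Module.End ℂ T) c *
      Module.End.eigenspace (ψ.toAlgHom.toLinearMap : Module.End ℂ T) d ≤
      Module.End.eigenspace (ψ.toAlgHom.toLinearMap : Module.End ℂ T) (c * d) := by
  refine Submodule.mul_le.mpr fun x hx y hy => ?_
  rw [Module.End.mem_eigenspace_iff] at hx hy ⊢
  change ψ x = _ at hx
  change ψ y = _ at hy
  change ψ (x * y) = _
  rw [map_mul, hx, hy, smul_mul_smul_comm]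

theorem pow_le_eigenspace (ψ : T →⋆ₐ[ℂ] T) {c : ℂ} {P : Submodule ℂ T}
    (hP : P ≤ Module.End.eigenspace (ψ.toAlgHom.toLinearMap : Module.End ℂ T) c) (k : ℕ) :
    P ^ k ≤ Module.End.eigenspace (ψ.toAlgHom.toLinearMap : Module.End ℂ T) (c ^ k) := by
  induction k with
  | zero =>
    rw [pow_zero, pow_zero, Submodule.one_le, Module.End.mem_eigenspace_iff, one_smul]
    exact map_one ψ
  | succ k ih =>
    rw [pow_succ, pow_succ]
    exact (mul_le_mul' ih hP).trans (eigenspace_mul_le ψ _ _)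

/-- Creators, coefficients and annihilators are eigenvectors of weights `z`, `1`, `z⁻¹`, and weights
multiply. -/
theorem gauge_words (hγι : ∀ z b, γ z (ι b) = ι b) (hγS : ∀ z, γ z S = (z : ℂ) • S) (z : Circle)
    {k l : ℕ} {x : T} (hx : x ∈ words ι S k l) : γ z x = (z : ℂ) ^ ((k : ℤ) - l) • x := by
  set V := Module.End.eigenspace ((γ z).toAlgHom.toLinearMap : Module.End ℂ T)
  have hB : coeffs ι ≤ V 1 := by
    rintro _ ⟨b, rfl⟩
    rw [Module.End.mem_eigenspace_iff, one_smul]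
    exact hγι z b
  have hX : creators ι S ≤ V z := by
    have h : Submodule.span ℂ {S} ≤ V z := by
      rw [Submodule.span_singleton_le_iff_mem, Module.End.mem_eigenspace_iff]
      exact hγS z
    simpa [creators, V] using (mul_le_mul' hB h).trans (eigenspace_mul_le (γ z) 1 z)
  have hY : annihilators ι S ≤ V (z : ℂ)⁻¹ := by
    have h : Submodule.span ℂ {star S} ≤ V (z : ℂ)⁻¹ := by
      rw [Submodule.span_singleton_le_iff_mem, Module.End.mem_eigenspace_iff]
      change γ z (star S) = _
      rw [map_star, hγS, star_smul, ← Circle.coe_inv, Circle.coe_inv_eq_conj]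
      rfl
    simpa [annihilators, V] using (mul_le_mul' h hB).trans (eigenspace_mul_le (γ z) _ 1)
  have h := ((mul_le_mul' ((mul_le_mul' (pow_le_eigenspace _ hX k) hB).trans
    (eigenspace_mul_le (γ z) _ _)) (pow_le_eigenspace _ hY l)).trans (eigenspace_mul_le (γ z) _ _)) hx
  rw [Module.End.mem_eigenspace_iff] at h
  refine Eq.trans h ?_
  rw [zpow_sub₀ (Circle.coe_ne_zero z), zpow_natCast, zpow_natCast, mul_one, inv_pow, div_eq_mul_inv]

theorem gauge_words_eq_fourier (hγι : ∀ z b, γ z (ι b) = ι b) (hγS : ∀ z, γ z S = (z : ℂ) • S)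
    {k l : ℕ} {x : T} (hx : x ∈ words ι S k l) (t : UnitAddCircle) :
    γ (toCircle t) x = fourier ((k : ℤ) - l) t • x := by
  rw [gauge_words hγι hγS _ hx, fourier_apply, toCircle_zsmul, Circle.coe_zpow]

/-- Orbits of words are characters times a vector. Each `γ z` is contractive, so approximation by
words is uniform over the circle. -/
theorem continuous_gauge (hS : ∀ b, ∃ b', star S * ι b * S = ι b')
    (hdense : ∀ x, x ∈ closure (StarAlgebra.adjoin ℂ (Set.range ι ∪ {S}) : Set T))
    (hγι : ∀ z b, γ z (ι b) = ι b) (hγS : ∀ z, γ z S = (z : ℂ) • S) (x : T) :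
    Continuous fun t : UnitAddCircle => γ (toCircle t) x := by
  have hW : ∀ y ∈ allWords ι S, Continuous fun t : UnitAddCircle => γ (toCircle t) y := by
    intro y hy
    induction hy using Submodule.iSup_induction' with
    | mem p y hy =>
      simp only [gauge_words_eq_fourier hγι hγS hy]
      exact (fourier _).continuous.smul continuous_const
    | zero => simpa using continuous_const
    | add x y _ _ hx hy => simp only [map_add]; exact hx.add hy
  refine continuous_of_uniform_approx_of_continuous fun u hu => ?_
  obtain ⟨δ, hδ, hδu⟩ := Metric.mem_uniformity_dist.mp hu
  obtain ⟨y, hy, hxy⟩ := Metric.mem_closure_iff.mp (hdense x) δ hδ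
  refine ⟨_, hW y (adjoin_le_allWords hS hy), fun t => hδu ?_⟩
  rw [dist_eq_norm, ← map_sub]
  exact (NonUnitalStarAlgHom.norm_apply_le _ _).trans_lt (by rwa [← dist_eq_norm])

theorem norm_fourierCoeff_le {E : Type*} [NormedAddCommGroup E] [NormedSpace ℂ E]
    {f : UnitAddCircle → E} {C : ℝ} (hC : ∀ t, ‖f t‖ ≤ C) (k : ℤ) : ‖fourierCoeff f k‖ ≤ C := by
  refine (norm_integral_le_of_norm_le_const (C := C)
    (Filter.Eventually.of_forall fun t => ?_)).trans (by simp)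
  rw [norm_smul, fourier_apply, Circle.norm_coe, one_mul]
  exact hC t

/-- Averaging over the circle keeps balanced words and kills the others by orthogonality of
characters. It is contractive, so the conclusion passes to limits of words. -/
theorem fourierCoeff_zero_gauge_mem (hS : ∀ b, ∃ b', star S * ι b * S = ι b')
    (hdense : ∀ x, x ∈ closure (StarAlgebra.adjoin ℂ (Set.range ι ∪ {S}) : Set T))
    (hγι : ∀ z b, γ z (ι b) = ι b) (hγS : ∀ z, γ z S = (z : ℂ) • S) (x : T) :
    fourierCoeff (fun t : UnitAddCircle => γ (toCircle t) x) 0 ∈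
      closure (⋃ N, (core ι S N : Set T)) := by
  have hcont := continuous_gauge hS hdense hγι hγS
  have hadd : ∀ y z, fourierCoeff (fun t : UnitAddCircle => γ (toCircle t) (y + z)) 0 =
      fourierCoeff (fun t : UnitAddCircle => γ (toCircle t) y) 0 +
      fourierCoeff (fun t : UnitAddCircle => γ (toCircle t) z) 0 := fun y z => by
    simp only [map_add]
    exact congrFun (fourierCoeff.add (integrable_of_continuous (hcont y))
      (integrable_of_continuous (hcont z))) 0
  have hW : ∀ y ∈ allWords ι S, fourierCoeff (fun t : UnitAddCircle => γ (toCircle t) y) 0 ∈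
      ⨆ N, core ι S N := by
    intro y hy
    induction hy using Submodule.iSup_induction' with
    | mem p y hy =>
      simp only [gauge_words_eq_fourier hγι hγS hy]
      have : fourierCoeff (fun t : UnitAddCircle => fourier ((p.1 : ℤ) - p.2) t • y) 0 =
          fourierCoeff (T := 1) (fourier ((p.1 : ℤ) - p.2)) 0 • y := by
        rw [fourierCoeff, fourierCoeff, ← integral_smul_const]
        simp only [smul_assoc]
      rw [this, fourierCoeff_fourier]
      by_cases h : p.1 = p.2
      · refine Submodule.smul_mem _ _ (Submodule.mem_iSup_of_mem p.2 (words_self_le_core _ ?_))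
        rwa [h] at hy
      · rw [Pi.single_eq_of_ne (by omega), zero_smul]
        exact zero_mem _
    | zero => simp [fourierCoeff]
    | add x y _ _ hx hy => rw [hadd]; exact add_mem hx hy
  rw [← Submodule.coe_iSup_of_directed _ (core_mono.directed_le)]
  refine Metric.mem_closure_iff.mpr fun δ hδ => ?_
  obtain ⟨y, hy, hxy⟩ := Metric.mem_closure_iff.mp (hdense x) δ hδ
  refine ⟨_, hW y (adjoin_le_allWords hS hy), ?_⟩
  have := hadd (x - y) y
  rw [sub_add_cancel] at this
  rw [dist_eq_norm, this, add_sub_cancel_right]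
  exact (norm_fourierCoeff_le (fun t => NonUnitalStarAlgHom.norm_apply_le _ _) 0).trans_lt
    (by rwa [← dist_eq_norm])

/-- A fixed element is its own average. -/
theorem mem_closure_core_of_fixed (hS : ∀ b, ∃ b', star S * ι b * S = ι b')
    (hdense : ∀ x, x ∈ closure (StarAlgebra.adjoin ℂ (Set.range ι ∪ {S}) : Set T))
    (hγι : ∀ z b, γ z (ι b) = ι b) (hγS : ∀ z, γ z S = (z : ℂ) • S) {x : T}
    (hx : ∀ t : UnitAddCircle, γ (toCircle t) x = x) :
    x ∈ closure (⋃ N, (core ι S N : Set T)) := by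
  have := fourierCoeff_zero_gauge_mem hS hdense hγι hγS x
  simpa [hx, fourierCoeff] using this

theorem gauge_fourierCoeff (hS : ∀ b, ∃ b', star S * ι b * S = ι b')
    (hdense : ∀ x, x ∈ closure (StarAlgebra.adjoin ℂ (Set.range ι ∪ {S}) : Set T))
    (hγι : ∀ z b, γ z (ι b) = ι b) (hγS : ∀ z, γ z S = (z : ℂ) • S)
    (hγmul : ∀ z w x, γ (z * w) x = γ z (γ w x)) (x : T) (k : ℤ) (s : UnitAddCircle) :
    γ (toCircle s) (fourierCoeff (fun t : UnitAddCircle => γ (toCircle t) x) k) =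
      fourier k s • fourierCoeff (fun t : UnitAddCircle => γ (toCircle t) x) k := by
  let L : T →L[ℂ] T := ⟨(γ (toCircle s)).toAlgHom.toLinearMap, starAlgHom_continuous _⟩
  rw [show γ (toCircle s) (fourierCoeff (fun t : UnitAddCircle => γ (toCircle t) x) k) =
    L (fourierCoeff (fun t : UnitAddCircle => γ (toCircle t) x) k) from rfl,
    ← fourierCoeff_clm L (continuous_gauge hS hdense hγι hγS x), fourierCoeff, fourierCoeff,
    ← integral_smul]
  -- Translation invariance of Haar measure: replacing `t` by `t + s` contributes `fourier (-k) s`,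
  -- which cancels `fourier k s`.
  rw [← integral_add_right_eq_self
    (fun t : UnitAddCircle => fourier k s • fourier (-k) t • γ (toCircle t) x) s]
  refine integral_congr_ae (Filter.Eventually.of_forall fun t => ?_)
  change fourier (-k) t • γ (toCircle s) (γ (toCircle t) x) =
    fourier k s • fourier (-k) (t + s) • γ (toCircle (t + s)) x
  rw [← hγmul, toCircle_add, mul_comm (toCircle t), ← smul_assoc]
  congr 1
  rw [fourier_apply, fourier_apply, fourier_apply, smul_add, toCircle_add, smul_eq_mul,
    Circle.coe_mul, mul_left_comm, ← Circle.coe_mul (toCircle (k • s)), ← toCircle_add, neg_smul,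
    neg_smul, add_neg_cancel, toCircle_zero]
  simp

variable {Z Z' : Type*} [NormedAddCommGroup Z] [NormedSpace ℂ Z] [NormedAddCommGroup Z']
  [NormedSpace ℂ Z']

/-- Let `T` be generated by the image of a C*-algebra `B` and an element `S` with `S* B S ⊆ B`,
carrying a gauge action, and let `φ` be a gauge-invariant *-homomorphism on `T`. Then the kernel of
`φ` is contained in every closed ideal `I ⊆ ker φ` which contains the coefficients in `ker φ`. -/
theorem mem_of_map_eq_zero (hS : ∀ b, ∃ b', star S * ι b * S = ι b')
    (hdense : ∀ x, x ∈ closure (StarAlgebra.adjoin ℂ (Set.range ι ∪ {S}) : Set T))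
    (hγι : ∀ z b, γ z (ι b) = ι b) (hγS : ∀ z, γ z S = (z : ℂ) • S)
    (hγmul : ∀ z w x, γ (z * w) x = γ z (γ w x)) (hγone : ∀ x, γ 1 x = x)
    (φ : T →⋆ₐ[ℂ] T₀) (hγφ : ∀ z x, φ x = 0 → φ (γ z x) = 0)
    {I : Ideal T} [I.IsTwoSided] (hI : IsClosed (I : Set T)) (hIφ : ∀ x ∈ I, φ x = 0)
    {ε : T →L[ℂ] Z} (hε : ∀ b t, ε (ι b * S * t) = 0) (hεn : ∀ b, ‖ε (ι b)‖ = ‖b‖)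
    {ι₀ : B → T₀} {S₀ : T₀} (hφι : ∀ b, φ (ι b) = ι₀ b) (hφS : φ S = S₀)
    {ε₀ : T₀ →L[ℂ] Z'} (hε₀ : ∀ b t, ε₀ (ι₀ b * S₀ * t) = 0)
    (hεI : ∀ b, ε₀ (ι₀ b) = 0 → ι b ∈ I) {x : T} (hx : φ x = 0) : x ∈ I := by
  have hcont := continuous_gauge hS hdense hγι hγS x
  let L : T →L[ℂ] T₀ := ⟨φ.toAlgHom.toLinearMap, starAlgHom_continuous _⟩
  have hL : ∀ t, ε₀.comp L t = ε₀ (φ t) := fun _ => rfl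
  have hcore := mem_of_mem_closure_core hS φ hI hIφ hε hεn (ε' := ε₀.comp L)
    (fun b t => by rw [hL, map_mul φ, map_mul φ, hφι, hφS, hε₀])
    (fun t ht => by rw [hL, ht, map_zero]) (fun b hb => hεI b (by rwa [hL, hφι] at hb))
  -- Once every Fourier coefficient of the orbit lies in `I`, so does its value at `0`, which is
  -- `x`.
  have h0 := apply_mem_of_fourierCoeff_mem (P := I.restrictScalars ℂ) hI hcont (fun k => ?_) 0
  · rwa [toCircle_zero, hγone] at h0
  -- A coefficient of weight `k` need not be in the core, but in `x_k* x_k` the weights cancel.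
  · refine mem_of_star_mul_self_mem I hI
      (mem_of_mem_closure_iUnion_core hS φ hI hcore
        (mem_closure_core_of_fixed hS hdense hγι hγS fun t => ?_) ?_)
    · rw [map_mul, map_star, gauge_fourierCoeff hS hdense hγι hγS hγmul, star_smul,
        smul_mul_smul_comm]
      have : star (fourier k t) * fourier k t = 1 := by
        rw [RCLike.star_def, ← fourier_neg, ← fourier_add]
        simp
      rw [this, one_smul]
    -- The whole orbit of `x` lies in `ker φ`, so `φ` of the coefficient is a coefficient of the
    -- zero function.
    · have : φ (fourierCoeff (fun t : UnitAddCircle => γ (toCircle t) x) k) = 0 := by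
        refine (fourierCoeff_clm L hcont k).symm.trans ?_
        have : (fun t : UnitAddCircle => L (γ (toCircle t) x)) = fun _ => 0 :=
          funext fun t => hγφ _ x hx
        rw [this]
        simp [fourierCoeff]
      rw [map_mul, this, mul_zero]

end Gauge

/-! ### Operators on alternating tensor products. -/

section AltTensors

variable {E F E' F' : HilbertSp.{u}}

/-- Bounded operators out of `E ⊗ (F ⊗ E ⊗ ⋯)` which agree on elementary tensors are equal. -/
theorem alt_succ_ext {G : Type*} [NormedAddCommGroup G] [NormedSpace ℂ G] {n : ℕ}
    {f g : alt E F (n + 1) →L[ℂ] G} (h : ∀ a w, f (creation F a n w) = g (creation F a n w)) :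
    f = g := by
  ext x
  change UniformSpace.Completion (E ⊗[ℂ] alt F E n) at x
  induction x using UniformSpace.Completion.induction_on with
  | hp => exact isClosed_eq f.continuous g.continuous
  | ih x =>
    induction x using TensorProduct.induction_on with
    | zero => exact (map_zero f).trans (map_zero g).symm
    | tmul a w => exact h a w
    | add x y hx hy =>
      rw [UniformSpace.Completion.coe_add]
      exact (map_add f _ _).trans ((congrArg₂ _ hx hy).trans (map_add g _ _).symm)

theorem leftOp_creation (T : E →L[ℂ] E) (n : ℕ) (a : E) (w : alt F E n) :
    leftOp F T (n + 1) (creation F a n w) = creation F (T a) n w :=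
  ContinuousLinearMap.completion_apply_coe _ _

theorem altIsometry_creation (f : E →ₗᵢ[ℂ] E') (g : F →ₗᵢ[ℂ] F') (n : ℕ) (a : E) (w : alt F E n) :
    altIsometry f g (n + 1) (creation F a n w) = creation F' (f a) n (altIsometry g f n w) :=
  ContinuousLinearMap.completion_apply_coe _ _

theorem inner_creation (a b : E) (n : ℕ) (w v : alt F E n) :
    inner ℂ (creation F a n w) (creation F b n v) = inner ℂ a b * inner ℂ w v :=
  (UniformSpace.Completion.inner_coe _ _).trans (TensorProduct.inner_tmul ..)

theorem adjoint_creation_apply (ξ a : E) (n : ℕ) (w : alt F E n) :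
    ContinuousLinearMap.adjoint (creation F ξ n) (creation F a n w) = inner ℂ ξ a • w := by
  refine ext_inner_left ℂ fun v => ?_
  rw [ContinuousLinearMap.adjoint_inner_right, inner_creation, inner_smul_right]

theorem creation_add (a b : E) (n : ℕ) (w : alt F E n) :
    creation F (a + b) n w = creation F a n w + creation F b n w :=
  (congrArg _ (TensorProduct.add_tmul a b w)).trans (UniformSpace.Completion.coe_add _ _)

theorem creation_smul (c : ℂ) (a : E) (n : ℕ) (w : alt F E n) :
    creation F (c • a) n w = c • creation F a n w :=
  (congrArg _ (TensorProduct.smul_tmul' c a w).symm).trans (UniformSpace.Completion.coe_smul _ _)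

theorem leftOp_one : ∀ n, leftOp F (1 : E →L[ℂ] E) n = 1
  | 0 => rfl
  | _ + 1 => alt_succ_ext fun _ _ => leftOp_creation _ _ _ _

theorem leftOp_mul (T T' : E →L[ℂ] E) : ∀ n, leftOp F (T * T') n = leftOp F T n * leftOp F T' n
  | 0 => rfl
  | n + 1 => alt_succ_ext fun a w => by
    rw [mul_apply_eq_comp, leftOp_creation, leftOp_creation, leftOp_creation,
      mul_apply_eq_comp]

theorem leftOp_add (T T' : E →L[ℂ] E) : ∀ n, leftOp F (T + T') n = leftOp F T n + leftOp F T' n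
  | 0 => rfl
  | n + 1 => alt_succ_ext fun a w => by
    rw [add_apply, leftOp_creation, leftOp_creation, leftOp_creation,
      add_apply, creation_add]

theorem leftOp_smul (c : ℂ) (T : E →L[ℂ] E) : ∀ n, leftOp F (c • T) n = c • leftOp F T n
  | 0 => rfl
  | n + 1 => alt_succ_ext fun a w => by
    rw [smul_apply, leftOp_creation, leftOp_creation,
      smul_apply, creation_smul]

theorem leftOp_star (T : E →L[ℂ] E) : ∀ n, leftOp F (star T) n = star (leftOp F T n)
  | 0 => rfl
  | n + 1 => alt_succ_ext fun a w => by
    refine ext_inner_left ℂ fun x => ?_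
    rw [ContinuousLinearMap.star_eq_adjoint (leftOp F T (n + 1)),
      ContinuousLinearMap.adjoint_inner_right, leftOp_creation]
    -- Only one vector has been reduced to an elementary tensor. The inner product is read as a
    -- bounded functional of the other, so that it can be reduced too.
    have : (innerSL ℂ (creation F ((star T) a) n w)) =
        (innerSL ℂ (creation F a n w)).comp (leftOp F T (n + 1)) := alt_succ_ext fun b v => by
      rw [ContinuousLinearMap.comp_apply, innerSL_apply_apply, innerSL_apply_apply,
        leftOp_creation, inner_creation, inner_creation, ContinuousLinearMap.star_eq_adjoint,
        ContinuousLinearMap.adjoint_inner_left]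
    have h := congrArg (fun f => f x) this
    simp only [ContinuousLinearMap.comp_apply, innerSL_apply_apply] at h
    rw [← inner_conj_symm, h, inner_conj_symm]

/-- The isometry `f ⊗ g ⊗ ⋯` intertwines the annihilation operators. -/
theorem adjoint_creation_altIsometry (f : E →ₗᵢ[ℂ] E') (g : F →ₗᵢ[ℂ] F') (ξ : E) (n : ℕ)
    (x : alt E F (n + 1)) :
    ContinuousLinearMap.adjoint (creation F' (f ξ) n) (altIsometry f g (n + 1) x) =
      altIsometry g f n (ContinuousLinearMap.adjoint (creation F ξ n) x) := by
  have : (ContinuousLinearMap.adjoint (creation F' (f ξ) n)).comp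
      (altIsometry f g (n + 1)).toContinuousLinearMap =
      (altIsometry g f n).toContinuousLinearMap.comp
        (ContinuousLinearMap.adjoint (creation F ξ n)) := alt_succ_ext fun a w => by
    simp only [ContinuousLinearMap.comp_apply, LinearIsometry.coe_toContinuousLinearMap]
    rw [altIsometry_creation, adjoint_creation_apply, adjoint_creation_apply, map_smul,
      LinearIsometry.inner_map_map]
  exact congrArg (fun f => f x) this

theorem leftOp_altIsometry {T : E →L[ℂ] E} {T' : E' →L[ℂ] E'} (f : E →ₗᵢ[ℂ] E')
    (g : F →ₗᵢ[ℂ] F') (hT : ∀ x, T' (f x) = f (T x)) : ∀ (n : ℕ) (x : alt E F n),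
    leftOp F' T' n (altIsometry f g n x) = altIsometry f g n (leftOp F T n x)
  | 0, x => hT x
  | n + 1, x => by
    have : (leftOp F' T' (n + 1)).comp (altIsometry f g (n + 1)).toContinuousLinearMap =
        (altIsometry f g (n + 1)).toContinuousLinearMap.comp (leftOp F T (n + 1)) :=
      alt_succ_ext fun a w => by
        simp only [ContinuousLinearMap.comp_apply, LinearIsometry.coe_toContinuousLinearMap]
        rw [altIsometry_creation, leftOp_creation, leftOp_creation, altIsometry_creation, hT]
    exact congrArg (fun f => f x) this

end AltTensors

/-! ### Creation operators and first-factor operators on the direct sums. -/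

section AltSums

variable {E F E' F' : HilbertSp.{u}}

theorem leftOpSum_apply (T : E →L[ℂ] E) (x : AltSum E F) (n : ℕ) :
    leftOpSum F T x n = leftOp F T n (x n) := rfl

theorem creationSum_apply_zero (ξ : E) (x : AltSum F E) : creationSum ξ x 0 = 0 := rfl

theorem creationSum_apply_succ (ξ : E) (x : AltSum F E) (n : ℕ) :
    creationSum ξ x (n + 1) = creation F ξ n (x n) := rfl

theorem altSumIsometry_apply (f : E →ₗᵢ[ℂ] E') (g : F →ₗᵢ[ℂ] F') (x : AltSum E F) (n : ℕ) :
    altSumIsometry f g x n = altIsometry f g n (x n) := rfl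

theorem adjoint_creationSum_apply (ξ : E) (x : AltSum E F) (n : ℕ) :
    ContinuousLinearMap.adjoint (creationSum (F := F) ξ) x n =
      ContinuousLinearMap.adjoint (creation F ξ n) (x (n + 1)) := by
  classical
  refine ext_inner_left ℂ fun v : alt F E n => ?_
  refine (lp.inner_single_left (G := fun n => alt F E n) n v _).symm.trans ?_
  rw [ContinuousLinearMap.adjoint_inner_right, ContinuousLinearMap.adjoint_inner_right]
  -- Testing against vectors in the single summand `n` suffices; creation moves them to summand `n +
  -- 1`.
  have : creationSum (F := F) ξ (lp.single 2 n v) = lp.single 2 (n + 1) (creation F ξ n v) := by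
    ext m
    cases m with
    | zero =>
      rw [creationSum_apply_zero, lp.single_apply_ne]
      exact (Nat.succ_ne_zero n).symm
    | succ m =>
      rw [creationSum_apply_succ]
      by_cases h : m = n
      · subst h
        rw [lp.single_apply_self, lp.single_apply_self]
      · rw [lp.single_apply_ne _ _ _ h, lp.single_apply_ne _ _ _ (by omega), map_zero]
  rw [this, lp.inner_single_left]

theorem leftOpSum_star (T : E →L[ℂ] E) : leftOpSum F (star T) = star (leftOpSum F T) := by
  rw [ContinuousLinearMap.star_eq_adjoint (leftOpSum F T), ContinuousLinearMap.eq_adjoint_iff]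
  intro x y
  rw [lp.inner_eq_tsum, lp.inner_eq_tsum]
  refine tsum_congr fun n => ?_
  rw [leftOpSum_apply, leftOpSum_apply, leftOp_star, ContinuousLinearMap.star_eq_adjoint,
    ContinuousLinearMap.adjoint_inner_left]

/-- `T` touches only the factor `ξ` just created, which annihilation then removes, leaving a scalar.
This is the source of `S* B S ⊆ B`. -/
theorem adjoint_creationSum_leftOpSum_creationSum (ξ : E) (T : E →L[ℂ] E) (x : AltSum F E) :
    ContinuousLinearMap.adjoint (creationSum (F := F) ξ) (leftOpSum F T (creationSum ξ x)) =
      inner ℂ ξ (T ξ) • x := by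
  ext n
  rw [adjoint_creationSum_apply, leftOpSum_apply, creationSum_apply_succ, leftOp_creation,
    adjoint_creation_apply]
  rfl

theorem adjoint_creationSum_altSumIsometry (f : E →ₗᵢ[ℂ] E') (g : F →ₗᵢ[ℂ] F') (ξ : E)
    (x : AltSum E F) :
    ContinuousLinearMap.adjoint (creationSum (F := F') (f ξ)) (altSumIsometry f g x) =
      altSumIsometry g f (ContinuousLinearMap.adjoint (creationSum (F := F) ξ) x) := by
  ext n
  rw [adjoint_creationSum_apply, altSumIsometry_apply, altSumIsometry_apply,
    adjoint_creation_altIsometry, adjoint_creationSum_apply]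

theorem creationSum_altSumIsometry (f : E →ₗᵢ[ℂ] E') (g : F →ₗᵢ[ℂ] F') (ξ : E) (x : AltSum F E) :
    creationSum (f ξ) (altSumIsometry g f x) = altSumIsometry f g (creationSum ξ x) := by
  ext n
  cases n with
  | zero => exact (map_zero (altIsometry f g 0)).symm
  | succ n => exact (altIsometry_creation f g n ξ (x n)).symm

theorem leftOpSum_altSumIsometry {T : E →L[ℂ] E} {T' : E' →L[ℂ] E'} (f : E →ₗᵢ[ℂ] E')
    (g : F →ₗᵢ[ℂ] F') (hT : ∀ x, T' (f x) = f (T x)) (x : AltSum E F) :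
    leftOpSum F' T' (altSumIsometry f g x) = altSumIsometry f g (leftOpSum F T x) := by
  ext n
  exact leftOp_altIsometry f g hT n (x n)

end AltSums

/-! ### The Fock space, its coefficient action and the Toeplitz-Pimsner algebra. -/

section Fock

variable {A B : Type*} [Ring A] [StarRing A] [Algebra ℂ A]
  [Ring B] [StarRing B] [Algebra ℂ B]
  {H H' G G' : Type u} [NormedAddCommGroup H] [InnerProductSpace ℂ H] [CompleteSpace H]
  [NormedAddCommGroup H'] [InnerProductSpace ℂ H'] [CompleteSpace H']
  [NormedAddCommGroup G] [InnerProductSpace ℂ G] [CompleteSpace G]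
  [NormedAddCommGroup G'] [InnerProductSpace ℂ G'] [CompleteSpace G']

theorem blockDiag_star {X Y : Type*} [NormedAddCommGroup X] [InnerProductSpace ℂ X]
    [CompleteSpace X] [NormedAddCommGroup Y] [InnerProductSpace ℂ Y] [CompleteSpace Y]
    (f : X →L[ℂ] X) (g : Y →L[ℂ] Y) : blockDiag (star f) (star g) = star (blockDiag f g) := by
  rw [ContinuousLinearMap.star_eq_adjoint, ContinuousLinearMap.star_eq_adjoint,
    ContinuousLinearMap.star_eq_adjoint, ContinuousLinearMap.eq_adjoint_iff]
  intro x y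
  simp [blockDiag, WithLp.prod_inner_apply, ContinuousLinearMap.adjoint_inner_left]

theorem fockRep_apply_fst (π : A →⋆ₐ[ℂ] (H →L[ℂ] H)) (ρ : B →⋆ₐ[ℂ] (H' →L[ℂ] H')) (a : A × B)
    (x : Fock H H') : (fockRep π ρ a x).fst = leftOpSum _ (π a.1) x.fst := rfl

theorem fockRep_apply_snd (π : A →⋆ₐ[ℂ] (H →L[ℂ] H)) (ρ : B →⋆ₐ[ℂ] (H' →L[ℂ] H')) (a : A × B)
    (x : Fock H H') : (fockRep π ρ a x).snd = leftOpSum _ (ρ a.2) x.snd := rfl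

theorem fock_ext {x y : Fock H H'} (h₁ : x.fst = y.fst) (h₂ : x.snd = y.snd) : x = y :=
  WithLp.ofLp_injective 2 (Prod.ext h₁ h₂)

theorem star_shift_apply (ξ : H) (ξ' : H') (x : Fock H H') :
    star (shift ξ ξ') x = WithLp.toLp 2
      (ContinuousLinearMap.adjoint (creationSum (E := .of H') (F := .of H) ξ') x.snd,
        ContinuousLinearMap.adjoint (creationSum (E := .of H) (F := .of H') ξ) x.fst) := by
  refine ext_inner_left ℂ fun y => ?_
  rw [ContinuousLinearMap.star_eq_adjoint, ContinuousLinearMap.adjoint_inner_right,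
    WithLp.prod_inner_apply, WithLp.prod_inner_apply]
  simp only [ContinuousLinearMap.adjoint_inner_right]
  exact add_comm _ _

/-- The representation `fockRep`, as a *-homomorphism. -/
noncomputable def fockHom (π : A →⋆ₐ[ℂ] (H →L[ℂ] H)) (ρ : B →⋆ₐ[ℂ] (H' →L[ℂ] H')) :
    A × B →⋆ₐ[ℂ] (Fock H H' →L[ℂ] Fock H H') where
  toFun := fockRep π ρ
  map_one' := by
    ext x : 1
    refine fock_ext (lp.ext (funext fun n => ?_)) (lp.ext (funext fun n => ?_))
    · rw [fockRep_apply_fst, leftOpSum_apply, Prod.fst_one, map_one, leftOp_one]; rfl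
    · rw [fockRep_apply_snd, leftOpSum_apply, Prod.snd_one, map_one, leftOp_one]; rfl
  map_mul' a b := by
    ext x : 1
    refine fock_ext (lp.ext (funext fun n => ?_)) (lp.ext (funext fun n => ?_))
    · rw [fockRep_apply_fst, leftOpSum_apply, Prod.fst_mul, map_mul, leftOp_mul]; rfl
    · rw [fockRep_apply_snd, leftOpSum_apply, Prod.snd_mul, map_mul, leftOp_mul]; rfl
  map_zero' := by
    ext x : 1
    refine fock_ext (lp.ext (funext fun n => ?_)) (lp.ext (funext fun n => ?_))
    · rw [fockRep_apply_fst, leftOpSum_apply, Prod.fst_zero, map_zero,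
        ← zero_smul ℂ (0 : H →L[ℂ] H), leftOp_smul, zero_smul]; rfl
    · rw [fockRep_apply_snd, leftOpSum_apply, Prod.snd_zero, map_zero,
        ← zero_smul ℂ (0 : H' →L[ℂ] H'), leftOp_smul, zero_smul]; rfl
  map_add' a b := by
    ext x : 1
    refine fock_ext (lp.ext (funext fun n => ?_)) (lp.ext (funext fun n => ?_))
    · rw [fockRep_apply_fst, leftOpSum_apply, Prod.fst_add, map_add, leftOp_add]; rfl
    · rw [fockRep_apply_snd, leftOpSum_apply, Prod.snd_add, map_add, leftOp_add]; rfl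
  commutes' r := by
    ext x : 1
    refine fock_ext (lp.ext (funext fun n => ?_)) (lp.ext (funext fun n => ?_))
    · rw [fockRep_apply_fst, leftOpSum_apply, Prod.algebraMap_apply, AlgHomClass.commutes π,
        Algebra.algebraMap_eq_smul_one, leftOp_smul, leftOp_one]; rfl
    · rw [fockRep_apply_snd, leftOpSum_apply, Prod.algebraMap_apply, AlgHomClass.commutes ρ,
        Algebra.algebraMap_eq_smul_one, leftOp_smul, leftOp_one]; rfl
  map_star' a := by
    change blockDiag _ _ = star (blockDiag _ _)
    rw [← blockDiag_star, ← leftOpSum_star, ← leftOpSum_star, ← map_star, ← map_star]; rfl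

theorem fockRep_star (π : A →⋆ₐ[ℂ] (H →L[ℂ] H)) (ρ : B →⋆ₐ[ℂ] (H' →L[ℂ] H')) (a : A × B) :
    fockRep π ρ (star a) = star (fockRep π ρ a) := map_star (fockHom π ρ) a

/-- `S* (a ⊕ b) S = ⟨ξ', b ξ'⟩ ⊕ ⟨ξ, a ξ⟩`. -/
theorem star_shift_mul_fockRep_mul_shift (π : A →⋆ₐ[ℂ] (H →L[ℂ] H))
    (ρ : B →⋆ₐ[ℂ] (H' →L[ℂ] H')) (ξ : H) (ξ' : H') (a : A × B) :
    star (shift ξ ξ') * fockRep π ρ a * shift ξ ξ' =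
      fockRep π ρ (inner ℂ ξ' (ρ a.2 ξ') • 1, inner ℂ ξ (π a.1 ξ) • 1) := by
  ext x : 1
  rw [mul_apply_eq_comp, mul_apply_eq_comp, star_shift_apply]
  refine fock_ext ?_ ?_
  -- `S` exchanges the two summands, so on the first one the scalar comes from `ρ` and `ξ'`.
  · refine (adjoint_creationSum_leftOpSum_creationSum (E := .of H') (F := .of H) ξ' (ρ a.2)
      x.fst).trans (lp.ext (funext fun n => ?_))
    rw [fockRep_apply_fst, leftOpSum_apply, map_smul, map_one, leftOp_smul, leftOp_one]; rfl
  · refine (adjoint_creationSum_leftOpSum_creationSum (E := .of H) (F := .of H') ξ (π a.1)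
      x.snd).trans (lp.ext (funext fun n => ?_))
    rw [fockRep_apply_snd, leftOpSum_apply, map_smul, map_one, leftOp_smul, leftOp_one]; rfl

theorem shift_fockIsometry (f : H →ₗᵢ[ℂ] G) (g : H' →ₗᵢ[ℂ] G') (ξ : H) (ξ' : H') (x : Fock H H') :
    shift (f ξ) (g ξ') (fockIsometry f g x) = fockIsometry f g (shift ξ ξ' x) :=
  fock_ext
    (creationSum_altSumIsometry (E := .of H) (F := .of H') (E' := .of G) (F' := .of G') f g ξ x.snd)
    (creationSum_altSumIsometry (E := .of H') (F := .of H) (E' := .of G') (F' := .of G) g f ξ' x.fst)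

theorem star_shift_fockIsometry (f : H →ₗᵢ[ℂ] G) (g : H' →ₗᵢ[ℂ] G') (ξ : H) (ξ' : H')
    (x : Fock H H') :
    star (shift (f ξ) (g ξ')) (fockIsometry f g x) =
      fockIsometry f g (star (shift ξ ξ') x) := by
  rw [star_shift_apply, star_shift_apply]
  exact fock_ext
    (adjoint_creationSum_altSumIsometry (E := .of H') (F := .of H) (E' := .of G') (F' := .of G)
      g f ξ' x.snd)
    (adjoint_creationSum_altSumIsometry (E := .of H) (F := .of H') (E' := .of G) (F' := .of G')
      f g ξ x.fst)

theorem fockRep_fockIsometry {C D : Type*} [Ring C] [StarRing C] [Algebra ℂ C]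
    [Ring D] [StarRing D] [Algebra ℂ D]
    {π : A →⋆ₐ[ℂ] (H →L[ℂ] H)} {ρ : B →⋆ₐ[ℂ] (H' →L[ℂ] H')}
    {σ : C →⋆ₐ[ℂ] (G →L[ℂ] G)} {τ : D →⋆ₐ[ℂ] (G' →L[ℂ] G')} (f : H →ₗᵢ[ℂ] G)
    (g : H' →ₗᵢ[ℂ] G') {a : A × B} {c : C × D} (hπ : ∀ x, σ c.1 (f x) = f (π a.1 x))
    (hρ : ∀ x, τ c.2 (g x) = g (ρ a.2 x)) (x : Fock H H') :
    fockRep σ τ c (fockIsometry f g x) = fockIsometry f g (fockRep π ρ a x) :=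
  fock_ext
    (leftOpSum_altSumIsometry (E := .of H) (F := .of H') (E' := .of G) (F' := .of G') f g hπ x.fst)
    (leftOpSum_altSumIsometry (E := .of H') (F := .of H) (E' := .of G') (F' := .of G) g f hρ x.snd)

theorem fockRep_mem (π : A →⋆ₐ[ℂ] (H →L[ℂ] H)) (ρ : B →⋆ₐ[ℂ] (H' →L[ℂ] H')) (ξ : H) (ξ' : H')
    (a : A × B) : fockRep π ρ a ∈ toeplitzAlgebra π ρ ξ ξ' :=
  StarSubalgebra.le_topologicalClosure _ (StarAlgebra.subset_adjoin ℂ _ (Or.inl ⟨a, rfl⟩))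

theorem shift_mem (π : A →⋆ₐ[ℂ] (H →L[ℂ] H)) (ρ : B →⋆ₐ[ℂ] (H' →L[ℂ] H')) (ξ : H) (ξ' : H') :
    shift ξ ξ' ∈ toeplitzAlgebra π ρ ξ ξ' :=
  StarSubalgebra.le_topologicalClosure _ (StarAlgebra.subset_adjoin ℂ _ (Or.inr rfl))

/-- Found by instance search, this gives the subalgebra its C*-algebra structure. -/
instance isClosed_toeplitzAlgebra (π : A →⋆ₐ[ℂ] (H →L[ℂ] H)) (ρ : B →⋆ₐ[ℂ] (H' →L[ℂ] H'))
    (ξ : H) (ξ' : H') : IsClosed (toeplitzAlgebra π ρ ξ ξ' : Set (Fock H H' →L[ℂ] Fock H H')) :=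
  StarSubalgebra.isClosed_topologicalClosure _

/-- The *-homomorphism from the coefficients to the Toeplitz-Pimsner algebra. -/
noncomputable def toeplitzHom (π : A →⋆ₐ[ℂ] (H →L[ℂ] H)) (ρ : B →⋆ₐ[ℂ] (H' →L[ℂ] H'))
    (ξ : H) (ξ' : H') : A × B →⋆ₐ[ℂ] toeplitzAlgebra π ρ ξ ξ' :=
  (fockHom π ρ).codRestrict _ (fockRep_mem π ρ ξ ξ')

/-- The element `S` of the Toeplitz-Pimsner algebra. -/
noncomputable def toeplitzShift (π : A →⋆ₐ[ℂ] (H →L[ℂ] H)) (ρ : B →⋆ₐ[ℂ] (H' →L[ℂ] H'))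
    (ξ : H) (ξ' : H') : toeplitzAlgebra π ρ ξ ξ' := ⟨shift ξ ξ', shift_mem π ρ ξ ξ'⟩

theorem star_toeplitzShift_mul_toeplitzHom_mul_toeplitzShift (π : A →⋆ₐ[ℂ] (H →L[ℂ] H))
    (ρ : B →⋆ₐ[ℂ] (H' →L[ℂ] H')) (ξ : H) (ξ' : H') (a : A × B) :
    star (toeplitzShift π ρ ξ ξ') * toeplitzHom π ρ ξ ξ' a * toeplitzShift π ρ ξ ξ' =
      toeplitzHom π ρ ξ ξ' (inner ℂ ξ' (ρ a.2 ξ') • 1, inner ℂ ξ (π a.1 ξ) • 1) :=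
  Subtype.ext (star_shift_mul_fockRep_mul_shift π ρ ξ ξ' a)

theorem mem_closure_adjoin_toeplitz (π : A →⋆ₐ[ℂ] (H →L[ℂ] H)) (ρ : B →⋆ₐ[ℂ] (H' →L[ℂ] H'))
    (ξ : H) (ξ' : H') (x : toeplitzAlgebra π ρ ξ ξ') :
    x ∈ closure (StarAlgebra.adjoin ℂ
      (Set.range (toeplitzHom π ρ ξ ξ') ∪ {toeplitzShift π ρ ξ ξ'}) :
        Set (toeplitzAlgebra π ρ ξ ξ')) := by
  have h : (Subtype.val '' (StarAlgebra.adjoin ℂ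
      (Set.range (toeplitzHom π ρ ξ ξ') ∪ {toeplitzShift π ρ ξ ξ'}) :
        Set (toeplitzAlgebra π ρ ξ ξ'))) =
      (StarAlgebra.adjoin ℂ (Set.range (fockRep π ρ) ∪ {shift ξ ξ'}) :
        Set (Fock H H' →L[ℂ] Fock H H')) := by
    have h1 := congrArg (fun s : StarSubalgebra ℂ (Fock H H' →L[ℂ] Fock H H') =>
      (s : Set (Fock H H' →L[ℂ] Fock H H')))
      (StarAlgHom.map_adjoin (toeplitzAlgebra π ρ ξ ξ').subtype
        (Set.range (toeplitzHom π ρ ξ ξ') ∪ {toeplitzShift π ρ ξ ξ'}))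
    rw [Set.image_union, ← Set.range_comp, Set.image_singleton] at h1
    exact h1
  rw [closure_subtype, h]
  exact x.2

end Fock

/-! ### Compression to a reducing subspace. -/

section Compression

variable {X Y : Type*} [NormedAddCommGroup X] [InnerProductSpace ℂ X] [CompleteSpace X]
  [NormedAddCommGroup Y] [InnerProductSpace ℂ Y] [CompleteSpace Y]

theorem adjoint_isometry_apply (V : X →ₗᵢ[ℂ] Y) (x : X) :
    ContinuousLinearMap.adjoint V.toContinuousLinearMap (V x) = x := by
  refine ext_inner_left ℂ fun y => ?_
  rw [ContinuousLinearMap.adjoint_inner_right]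
  exact V.inner_map_map y x

theorem compression_apply (V : X →ₗᵢ[ℂ] Y) (T : Y →L[ℂ] Y) (x : X) :
    compression V T x = ContinuousLinearMap.adjoint V.toContinuousLinearMap (T (V x)) := rfl

theorem compression_eq {V : X →ₗᵢ[ℂ] Y} {T : Y →L[ℂ] Y} {R : X →L[ℂ] X}
    (h : ∀ x, T (V x) = V (R x)) : compression V T = R := by
  ext x
  rw [compression_apply, h, adjoint_isometry_apply]

theorem continuous_compression (V : X →ₗᵢ[ℂ] Y) : Continuous (compression V) :=
  continuous_const.clm_comp (continuous_id.clm_comp continuous_const)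

theorem compression_add (V : X →ₗᵢ[ℂ] Y) (T T' : Y →L[ℂ] Y) :
    compression V (T + T') = compression V T + compression V T' := by
  ext x
  simp [compression_apply]

theorem compression_star (V : X →ₗᵢ[ℂ] Y) (T : Y →L[ℂ] Y) :
    compression V (star T) = star (compression V T) := by
  rw [ContinuousLinearMap.star_eq_adjoint, ContinuousLinearMap.star_eq_adjoint,
    ContinuousLinearMap.eq_adjoint_iff]
  intro x y
  rw [compression_apply, compression_apply, ContinuousLinearMap.adjoint_inner_left,
    ContinuousLinearMap.adjoint_inner_left, ContinuousLinearMap.adjoint_inner_right]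
  rfl

/-- Compression is not multiplicative in general; it suffices that the right factor leaves the range
of `V` invariant. -/
theorem compression_mul {V : X →ₗᵢ[ℂ] Y} (T : Y →L[ℂ] Y) {T' : Y →L[ℂ] Y}
    (h : ∀ x, T' (V x) = V (compression V T' x)) :
    compression V (T * T') = compression V T * compression V T' := by
  ext x
  rw [compression_apply, mul_apply_eq_comp, mul_apply_eq_comp, h, compression_apply V T]

theorem compression_algebraMap (V : X →ₗᵢ[ℂ] Y) (r : ℂ) :
    compression V (algebraMap ℂ _ r) = algebraMap ℂ _ r :=
  compression_eq fun x => by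
    simp [Algebra.algebraMap_eq_smul_one]

/-- If every element of `s`, together with its adjoint, restricts to `X` as an element of
the *-algebra `R`, then so does every element of the C*-algebra generated by `s`. -/
theorem compression_mem_of_mem_closure (V : X →ₗᵢ[ℂ] Y) {s : Set (Y →L[ℂ] Y)}
    (R : StarSubalgebra ℂ (X →L[ℂ] X)) (hR : IsClosed (R : Set (X →L[ℂ] X)))
    (h : ∀ T ∈ s, ∃ T₀ ∈ R, (∀ x, T (V x) = V (T₀ x)) ∧ ∀ x, star T (V x) = V (star T₀ x))
    {T : Y →L[ℂ] Y} (hT : T ∈ (StarAlgebra.adjoin ℂ s).topologicalClosure) :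
    compression V T ∈ R ∧ ∀ x, T (V x) = V (compression V T x) := by
  -- Carrying the relation for the adjoint as well makes the statement symmetric, so the induction
  -- survives the `star` case.
  have key : ∀ T ∈ StarAlgebra.adjoin ℂ s,
      ∃ T₀ ∈ R, (∀ x, T (V x) = V (T₀ x)) ∧ ∀ x, star T (V x) = V (star T₀ x) := by
    intro T hT
    induction hT using StarAlgebra.adjoin_induction with
    | mem T hT => exact h T hT
    | algebraMap r =>
      refine ⟨algebraMap ℂ _ r, algebraMap_mem R r, fun x => ?_, fun x => ?_⟩ <;>
      simp [Algebra.algebraMap_eq_smul_one]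
    | add T T' _ _ h h' =>
      obtain ⟨T₀, hT₀, h1, h2⟩ := h
      obtain ⟨T₀', hT₀', h1', h2'⟩ := h'
      exact ⟨T₀ + T₀', add_mem hT₀ hT₀', fun x => by simp [h1, h1'], fun x => by simp [h2, h2']⟩
    | mul T T' _ _ h h' =>
      obtain ⟨T₀, hT₀, h1, h2⟩ := h
      obtain ⟨T₀', hT₀', h1', h2'⟩ := h'
      exact ⟨T₀ * T₀', mul_mem hT₀ hT₀', fun x => by simp [h1, h1'], fun x => by simp [h2, h2']⟩
    | star T _ h =>
      obtain ⟨T₀, hT₀, h1, h2⟩ := h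
      exact ⟨star T₀, star_mem hT₀, h2, by simpa using h1⟩
  -- With the witness `T₀` replaced by `compression V T`, the condition is closed in `T`.
  have hcl : IsClosed {T : Y →L[ℂ] Y |
      compression V T ∈ R ∧ ∀ x, T (V x) = V (compression V T x)} := by
    refine (hR.preimage (continuous_compression V)).and ?_
    simp only [Set.ofPred_forall]
    exact isClosed_iInter fun x => isClosed_eq (by fun_prop)
      (V.continuous.comp ((continuous_compression V).clm_apply continuous_const))
  refine closure_minimal (t := {T : Y →L[ℂ] Y |
      compression V T ∈ R ∧ ∀ x, T (V x) = V (compression V T x)}) (fun T hT => ?_) hcl hT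
  obtain ⟨T₀, hT₀, h1, -⟩ := key T hT
  rw [Set.mem_ofPred_eq, compression_eq h1]
  exact ⟨hT₀, h1⟩

end Compression

/-! ### The gauge action on the Fock space. -/

section GaugeAction

variable {A B : Type*} [Ring A] [StarRing A] [Algebra ℂ A]
  [Ring B] [StarRing B] [Algebra ℂ B]
  {H H' G G' : Type u} [NormedAddCommGroup H] [InnerProductSpace ℂ H] [CompleteSpace H]
  [NormedAddCommGroup H'] [InnerProductSpace ℂ H'] [CompleteSpace H']
  [NormedAddCommGroup G] [InnerProductSpace ℂ G] [CompleteSpace G]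
  [NormedAddCommGroup G'] [InnerProductSpace ℂ G'] [CompleteSpace G']

/-- Multiplication by `z ^ n` on the `n`-th summand. -/
noncomputable def altGauge (E F : HilbertSp.{u}) (z : Circle) : AltSum E F →L[ℂ] AltSum E F :=
  lp.mapCLM 2 (fun n => ((z : ℂ) ^ n) • ContinuousLinearMap.id ℂ (alt E F n)) zero_le_one fun n => by
    refine (norm_smul_le _ _).trans ?_
    rw [norm_pow, Circle.norm_coe, one_pow, one_mul]
    exact ContinuousLinearMap.norm_id_le

theorem altGauge_apply {E F : HilbertSp.{u}} (z : Circle) (x : AltSum E F) (n : ℕ) :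
    altGauge E F z x n = (z : ℂ) ^ n • x n := rfl

theorem altGauge_star {E F : HilbertSp.{u}} (z : Circle) :
    altGauge E F z⁻¹ = star (altGauge E F z) := by
  rw [ContinuousLinearMap.star_eq_adjoint, ContinuousLinearMap.eq_adjoint_iff]
  intro x y
  rw [lp.inner_eq_tsum, lp.inner_eq_tsum]
  refine tsum_congr fun n => ?_
  rw [altGauge_apply, altGauge_apply, inner_smul_left, inner_smul_right, Circle.coe_inv_eq_conj,
    map_pow, Complex.conj_conj]

variable (H H') in
/-- The gauge unitary, multiplying the words with `n + 1` tensor factors by `z ^ n`. -/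
noncomputable def fockGauge (z : Circle) : Fock H H' →L[ℂ] Fock H H' :=
  blockDiag (altGauge _ _ z) (altGauge _ _ z)

theorem fockGauge_one : fockGauge H H' 1 = 1 := by
  ext x : 1
  refine fock_ext (lp.ext (funext fun n => ?_)) (lp.ext (funext fun n => ?_))
  · refine (altGauge_apply 1 x.fst n).trans ?_
    rw [Circle.coe_one, one_pow, one_smul]; rfl
  · refine (altGauge_apply 1 x.snd n).trans ?_
    rw [Circle.coe_one, one_pow, one_smul]; rfl

theorem fockGauge_mul (z w : Circle) :
    fockGauge H H' (z * w) = fockGauge H H' z * fockGauge H H' w := by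
  ext x : 1
  refine fock_ext (lp.ext (funext fun n => ?_)) (lp.ext (funext fun n => ?_))
  · refine (altGauge_apply (z * w) x.fst n).trans ?_
    rw [Circle.coe_mul, mul_pow, mul_smul]; rfl
  · refine (altGauge_apply (z * w) x.snd n).trans ?_
    rw [Circle.coe_mul, mul_pow, mul_smul]; rfl

theorem fockGauge_inv (z : Circle) : fockGauge H H' z⁻¹ = star (fockGauge H H' z) := by
  rw [fockGauge, fockGauge, ← blockDiag_star, altGauge_star, altGauge_star]

theorem fockGauge_mem_unitary (z : Circle) :
    fockGauge H H' z ∈ unitary (Fock H H' →L[ℂ] Fock H H') := by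
  constructor
  · rw [← fockGauge_inv, ← fockGauge_mul, inv_mul_cancel, fockGauge_one]
  · rw [← fockGauge_inv, ← fockGauge_mul, mul_inv_cancel, fockGauge_one]

theorem fockGauge_mul_fockRep (π : A →⋆ₐ[ℂ] (H →L[ℂ] H)) (ρ : B →⋆ₐ[ℂ] (H' →L[ℂ] H')) (z : Circle)
    (a : A × B) : fockGauge H H' z * fockRep π ρ a = fockRep π ρ a * fockGauge H H' z := by
  ext x : 1
  refine fock_ext (lp.ext (funext fun n => ?_)) (lp.ext (funext fun n => ?_))
  · exact (map_smul (leftOp (E := .of H) (.of H') (π a.1) n) ((z : ℂ) ^ n) (x.fst n)).symm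
  · exact (map_smul (leftOp (E := .of H') (.of H) (ρ a.2) n) ((z : ℂ) ^ n) (x.snd n)).symm

/-- Creation raises the degree by one, which costs one factor `z`. -/
theorem altGauge_creationSum {E F : HilbertSp.{u}} (z : Circle) (ξ : E) (x : AltSum F E) :
    altGauge E F z (creationSum ξ x) = (z : ℂ) • creationSum ξ (altGauge F E z x) := by
  ext n
  cases n with
  | zero => exact (smul_zero _).trans (smul_zero _).symm
  | succ n =>
    refine (altGauge_apply z _ _).trans ?_
    refine Eq.trans ?_ (congrArg ((z : ℂ) • ·) (map_smul (creation F ξ n) ((z : ℂ) ^ n) (x n)).symm)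
    rw [creationSum_apply_succ, pow_succ', mul_smul]

theorem fockGauge_mul_shift (z : Circle) (ξ : H) (ξ' : H') :
    fockGauge H H' z * shift ξ ξ' = (z : ℂ) • (shift ξ ξ' * fockGauge H H' z) := by
  ext x : 1
  exact fock_ext (altGauge_creationSum (E := .of H) (F := .of H') z ξ x.snd)
    (altGauge_creationSum (E := .of H') (F := .of H) z ξ' x.fst)

theorem fockGauge_fockIsometry (f : H →ₗᵢ[ℂ] G) (g : H' →ₗᵢ[ℂ] G') (z : Circle) (x : Fock H H') :
    fockGauge G G' z (fockIsometry f g x) = fockIsometry f g (fockGauge H H' z x) := by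
  refine fock_ext (lp.ext (funext fun n => ?_)) (lp.ext (funext fun n => ?_))
  · exact (map_smul (altIsometry (E := .of H) (F := .of H') (E' := .of G) (F' := .of G') f g n)
      ((z : ℂ) ^ n) (x.fst n)).symm
  · exact (map_smul (altIsometry (E := .of H') (F := .of H) (E' := .of G') (F' := .of G) g f n)
      ((z : ℂ) ^ n) (x.snd n)).symm

variable (H H') in
/-- The gauge action on the bounded operators. -/
noncomputable def gaugeHom (z : Circle) :
    (Fock H H' →L[ℂ] Fock H H') →⋆ₐ[ℂ] (Fock H H' →L[ℂ] Fock H H') :=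
  (Unitary.conjStarAlgAut ℂ _ ⟨fockGauge H H' z, fockGauge_mem_unitary z⟩).toStarAlgHom

theorem gaugeHom_apply (z : Circle) (T : Fock H H' →L[ℂ] Fock H H') :
    gaugeHom H H' z T = fockGauge H H' z * T * fockGauge H H' z⁻¹ := by
  rw [fockGauge_inv]; rfl

theorem gaugeHom_fockRep (π : A →⋆ₐ[ℂ] (H →L[ℂ] H)) (ρ : B →⋆ₐ[ℂ] (H' →L[ℂ] H')) (z : Circle)
    (a : A × B) : gaugeHom H H' z (fockRep π ρ a) = fockRep π ρ a := by
  rw [gaugeHom_apply, fockGauge_mul_fockRep, mul_assoc, ← fockGauge_mul, mul_inv_cancel,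
    fockGauge_one, mul_one]

theorem gaugeHom_shift (z : Circle) (ξ : H) (ξ' : H') :
    gaugeHom H H' z (shift ξ ξ') = (z : ℂ) • shift ξ ξ' := by
  rw [gaugeHom_apply, fockGauge_mul_shift, smul_mul_assoc, mul_assoc, ← fockGauge_mul,
    mul_inv_cancel, fockGauge_one, mul_one]

theorem gaugeHom_mul (z w : Circle) (T : Fock H H' →L[ℂ] Fock H H') :
    gaugeHom H H' (z * w) T = gaugeHom H H' z (gaugeHom H H' w T) := by
  simp only [gaugeHom_apply, mul_inv_rev, fockGauge_mul, mul_assoc]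

theorem gaugeHom_one (T : Fock H H' →L[ℂ] Fock H H') : gaugeHom H H' 1 T = T := by
  rw [gaugeHom_apply, inv_one, fockGauge_one, one_mul, mul_one]

theorem continuous_gaugeHom (z : Circle) : Continuous (gaugeHom H H' z) := by
  simp only [funext (gaugeHom_apply z)]
  fun_prop

theorem gaugeHom_mem (π : A →⋆ₐ[ℂ] (H →L[ℂ] H)) (ρ : B →⋆ₐ[ℂ] (H' →L[ℂ] H')) (ξ : H) (ξ' : H')
    (z : Circle) {T : Fock H H' →L[ℂ] Fock H H'} (hT : T ∈ toeplitzAlgebra π ρ ξ ξ') :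
    gaugeHom H H' z T ∈ toeplitzAlgebra π ρ ξ ξ' := by
  refine map_mem_closure (continuous_gaugeHom z) hT fun T hT => ?_
  have h : StarAlgebra.adjoin ℂ (Set.range (fockRep π ρ) ∪ {shift ξ ξ'}) ≤
      (StarAlgebra.adjoin ℂ (Set.range (fockRep π ρ) ∪ {shift ξ ξ'})).comap (gaugeHom H H' z) := by
    refine StarAlgebra.adjoin_le ?_
    rintro _ (⟨a, rfl⟩ | rfl)
    · change gaugeHom H H' z (fockRep π ρ a) ∈ StarAlgebra.adjoin ℂ _
      rw [gaugeHom_fockRep]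
      exact StarAlgebra.subset_adjoin ℂ _ (Or.inl ⟨a, rfl⟩)
    · change gaugeHom H H' z (shift ξ ξ') ∈ StarAlgebra.adjoin ℂ _
      rw [gaugeHom_shift]
      exact SMulMemClass.smul_mem _ (StarAlgebra.subset_adjoin ℂ _ (Or.inr rfl))
  exact h hT

/-- The gauge action on the Toeplitz-Pimsner algebra. -/
noncomputable def toeplitzGauge (π : A →⋆ₐ[ℂ] (H →L[ℂ] H)) (ρ : B →⋆ₐ[ℂ] (H' →L[ℂ] H')) (ξ : H)
    (ξ' : H') (z : Circle) : toeplitzAlgebra π ρ ξ ξ' →⋆ₐ[ℂ] toeplitzAlgebra π ρ ξ ξ' :=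
  ((gaugeHom H H' z).comp (toeplitzAlgebra π ρ ξ ξ').subtype).codRestrict _ fun T => gaugeHom_mem π ρ ξ ξ' z T.2

theorem coe_toeplitzGauge (π : A →⋆ₐ[ℂ] (H →L[ℂ] H)) (ρ : B →⋆ₐ[ℂ] (H' →L[ℂ] H')) (ξ : H)
    (ξ' : H') (z : Circle) (T : toeplitzAlgebra π ρ ξ ξ') :
    (toeplitzGauge π ρ ξ ξ' z T : Fock H H' →L[ℂ] Fock H H') = gaugeHom H H' z T := rfl

theorem toeplitzGauge_toeplitzHom (π : A →⋆ₐ[ℂ] (H →L[ℂ] H)) (ρ : B →⋆ₐ[ℂ] (H' →L[ℂ] H'))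
    (ξ : H) (ξ' : H') (z : Circle) (a : A × B) :
    toeplitzGauge π ρ ξ ξ' z (toeplitzHom π ρ ξ ξ' a) = toeplitzHom π ρ ξ ξ' a :=
  Subtype.ext (gaugeHom_fockRep π ρ z a)

theorem toeplitzGauge_toeplitzShift (π : A →⋆ₐ[ℂ] (H →L[ℂ] H)) (ρ : B →⋆ₐ[ℂ] (H' →L[ℂ] H'))
    (ξ : H) (ξ' : H') (z : Circle) :
    toeplitzGauge π ρ ξ ξ' z (toeplitzShift π ρ ξ ξ') = (z : ℂ) • toeplitzShift π ρ ξ ξ' := by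
  refine Subtype.ext ?_
  rw [coe_toeplitzGauge, SetLike.val_smul]
  exact gaugeHom_shift z ξ ξ'

theorem toeplitzGauge_mul (π : A →⋆ₐ[ℂ] (H →L[ℂ] H)) (ρ : B →⋆ₐ[ℂ] (H' →L[ℂ] H'))
    (ξ : H) (ξ' : H') (z w : Circle) (T : toeplitzAlgebra π ρ ξ ξ') :
    toeplitzGauge π ρ ξ ξ' (z * w) T = toeplitzGauge π ρ ξ ξ' z (toeplitzGauge π ρ ξ ξ' w T) := by
  refine Subtype.ext ?_
  rw [coe_toeplitzGauge, coe_toeplitzGauge, coe_toeplitzGauge, gaugeHom_mul]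

theorem toeplitzGauge_one (π : A →⋆ₐ[ℂ] (H →L[ℂ] H)) (ρ : B →⋆ₐ[ℂ] (H' →L[ℂ] H'))
    (ξ : H) (ξ' : H') (T : toeplitzAlgebra π ρ ξ ξ') : toeplitzGauge π ρ ξ ξ' 1 T = T := by
  refine Subtype.ext ?_
  rw [coe_toeplitzGauge, gaugeHom_one]

theorem adjoint_fockIsometry_fockGauge (f : H →ₗᵢ[ℂ] G) (g : H' →ₗᵢ[ℂ] G') (z : Circle)
    (y : Fock G G') :
    ContinuousLinearMap.adjoint (fockIsometry f g).toContinuousLinearMap (fockGauge G G' z y) =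
      fockGauge H H' z
        (ContinuousLinearMap.adjoint (fockIsometry f g).toContinuousLinearMap y) := by
  have h : ∀ {K K' : Type u} [NormedAddCommGroup K] [InnerProductSpace ℂ K] [CompleteSpace K]
      [NormedAddCommGroup K'] [InnerProductSpace ℂ K'] [CompleteSpace K'] (v w : Fock K K'),
      inner ℂ v (fockGauge K K' z w) = inner ℂ (fockGauge K K' z⁻¹ v) w := fun v w => by
    rw [fockGauge_inv, ContinuousLinearMap.star_eq_adjoint, ContinuousLinearMap.adjoint_inner_left]
  refine ext_inner_left ℂ fun x => ?_
  rw [ContinuousLinearMap.adjoint_inner_right, h, h, ContinuousLinearMap.adjoint_inner_right,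
    LinearIsometry.coe_toContinuousLinearMap, fockGauge_fockIsometry]

/-- The inclusion of Fock spaces respects word length, so it and its adjoint intertwine the gauge
unitaries. Consequently the kernel of the compression is gauge-invariant. -/
theorem compression_gaugeHom (f : H →ₗᵢ[ℂ] G) (g : H' →ₗᵢ[ℂ] G') (z : Circle)
    (T : Fock G G' →L[ℂ] Fock G G') :
    compression (fockIsometry f g) (gaugeHom G G' z T) =
      gaugeHom H H' z (compression (fockIsometry f g) T) := by
  ext x : 1
  rw [compression_apply, gaugeHom_apply, gaugeHom_apply, mul_apply_eq_comp, mul_apply_eq_comp,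
    mul_apply_eq_comp, mul_apply_eq_comp, fockGauge_fockIsometry, compression_apply,
    adjoint_fockIsometry_fockGauge]

end GaugeAction

/-! ### Compression to words of length one. -/

section FirstLevel

variable {A B : Type*} [Ring A] [StarRing A] [Algebra ℂ A]
  [Ring B] [StarRing B] [Algebra ℂ B]
  {H H' : Type u} [NormedAddCommGroup H] [InnerProductSpace ℂ H] [CompleteSpace H]
  [NormedAddCommGroup H'] [InnerProductSpace ℂ H'] [CompleteSpace H']

variable (H H') in
/-- The projection of the Fock space onto the words of length one in `H`. -/
noncomputable def projFst : Fock H H' →L[ℂ] H :=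
  (lp.evalCLM ℂ (fun n => alt (.of H) (.of H') n) 2 0).comp (WithLp.fstL 2 ℂ _ _)

variable (H H') in
/-- The projection of the Fock space onto the words of length one in `H'`. -/
noncomputable def projSnd : Fock H H' →L[ℂ] H' :=
  (lp.evalCLM ℂ (fun n => alt (.of H') (.of H) n) 2 0).comp (WithLp.sndL 2 ℂ _ _)

variable (H H') in
/-- The inclusion of `H` into the Fock space as words of length one. -/
noncomputable def inclWordFst : H →L[ℂ] Fock H H' :=
  (WithLp.prodContinuousLinearEquiv 2 ℂ _ _).symm.toContinuousLinearMap.comp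
    ((ContinuousLinearMap.inl ℂ _ _).comp
      (lp.singleContinuousLinearMap ℂ (fun n => alt (.of H) (.of H') n) 2 0))

variable (H H') in
/-- The inclusion of `H'` into the Fock space as words of length one. -/
noncomputable def inclWordSnd : H' →L[ℂ] Fock H H' :=
  (WithLp.prodContinuousLinearEquiv 2 ℂ _ _).symm.toContinuousLinearMap.comp
    ((ContinuousLinearMap.inr ℂ _ _).comp
      (lp.singleContinuousLinearMap ℂ (fun n => alt (.of H') (.of H) n) 2 0))

theorem projFst_inclWordFst (x : H) : projFst H H' (inclWordFst H H' x) = x :=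
  lp.single_apply_self (E := fun n => alt (.of H) (.of H') n) 2 0 x

theorem projSnd_inclWordSnd (x : H') : projSnd H H' (inclWordSnd H H' x) = x :=
  lp.single_apply_self (E := fun n => alt (.of H') (.of H) n) 2 0 x

variable (H H') in
/-- The compression of operators on the Fock space to the words of length one. -/
noncomputable def firstLevel :
    (Fock H H' →L[ℂ] Fock H H') →L[ℂ] (H →L[ℂ] H) × (H' →L[ℂ] H') :=
  (((ContinuousLinearMap.compL ℂ H (Fock H H') H) (projFst H H')).comp
      ((ContinuousLinearMap.compL ℂ H (Fock H H') (Fock H H')).flip (inclWordFst H H'))).prod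
    (((ContinuousLinearMap.compL ℂ H' (Fock H H') H') (projSnd H H')).comp
      ((ContinuousLinearMap.compL ℂ H' (Fock H H') (Fock H H')).flip (inclWordSnd H H')))

theorem firstLevel_apply (T : Fock H H' →L[ℂ] Fock H H') :
    firstLevel H H' T = ((projFst H H').comp (T.comp (inclWordFst H H')),
      (projSnd H H').comp (T.comp (inclWordSnd H H'))) := rfl

theorem firstLevel_fockRep (π : A →⋆ₐ[ℂ] (H →L[ℂ] H)) (ρ : B →⋆ₐ[ℂ] (H' →L[ℂ] H')) (a : A × B) :
    firstLevel H H' (fockRep π ρ a) = (π a.1, ρ a.2) := by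
  rw [firstLevel_apply]
  refine Prod.ext ?_ ?_
  · ext x
    exact congrArg (π a.1) (projFst_inclWordFst (H' := H') x)
  · ext x
    exact congrArg (ρ a.2) (projSnd_inclWordSnd (H := H) x)

/-- The range of `S` has no component of length one, and the coefficients preserve word length. -/
theorem firstLevel_fockRep_mul_shift_mul (π : A →⋆ₐ[ℂ] (H →L[ℂ] H))
    (ρ : B →⋆ₐ[ℂ] (H' →L[ℂ] H')) (ξ : H) (ξ' : H') (a : A × B) (T : Fock H H' →L[ℂ] Fock H H') :
    firstLevel H H' (fockRep π ρ a * shift ξ ξ' * T) = 0 := by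
  rw [firstLevel_apply]
  refine Prod.ext ?_ ?_
  · ext x
    exact map_zero (π a.1)
  · ext x
    exact map_zero (ρ a.2)

/-- The compression of the Toeplitz-Pimsner algebra to the words of length one. -/
noncomputable def toeplitzFirstLevel (π : A →⋆ₐ[ℂ] (H →L[ℂ] H)) (ρ : B →⋆ₐ[ℂ] (H' →L[ℂ] H'))
    (ξ : H) (ξ' : H') : toeplitzAlgebra π ρ ξ ξ' →L[ℂ] (H →L[ℂ] H) × (H' →L[ℂ] H') :=
  (firstLevel H H').comp (toeplitzAlgebra π ρ ξ ξ').toSubalgebra.toSubmodule.subtypeL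

theorem toeplitzFirstLevel_toeplitzHom (π : A →⋆ₐ[ℂ] (H →L[ℂ] H))
    (ρ : B →⋆ₐ[ℂ] (H' →L[ℂ] H')) (ξ : H) (ξ' : H') (a : A × B) :
    toeplitzFirstLevel π ρ ξ ξ' (toeplitzHom π ρ ξ ξ' a) = (π a.1, ρ a.2) :=
  firstLevel_fockRep π ρ a

theorem toeplitzFirstLevel_mul_toeplitzShift_mul (π : A →⋆ₐ[ℂ] (H →L[ℂ] H))
    (ρ : B →⋆ₐ[ℂ] (H' →L[ℂ] H')) (ξ : H) (ξ' : H') (a : A × B) (T : toeplitzAlgebra π ρ ξ ξ') :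
    toeplitzFirstLevel π ρ ξ ξ' (toeplitzHom π ρ ξ ξ' a * toeplitzShift π ρ ξ ξ' * T) = 0 :=
  firstLevel_fockRep_mul_shift_mul π ρ ξ ξ' a T.1

end FirstLevel

/-! ### The compression as a quotient map, and its kernel. -/

section Main

theorem isTwoSided_closure {R : Type*} [Ring R] [TopologicalSpace R]
    [IsTopologicalRing R] (I : Ideal R) [I.IsTwoSided] : I.closure.IsTwoSided where
  mul_mem_of_left b ha :=
    map_mem_closure (f := fun t => t * b) (by fun_prop) ha fun _ ht => I.mul_mem_right b ht

section Ideal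

variable {A B : Type*} [Ring A] [StarRing A] [Algebra ℂ A]
  [Ring B] [StarRing B] [Algebra ℂ B]
  {H H' : Type u} [NormedAddCommGroup H] [InnerProductSpace ℂ H] [CompleteSpace H]
  [NormedAddCommGroup H'] [InnerProductSpace ℂ H'] [CompleteSpace H']
  (J : Ideal A) (π : A →⋆ₐ[ℂ] (H →L[ℂ] H)) (ρ : B →⋆ₐ[ℂ] (H' →L[ℂ] H')) (ξ : H) (ξ' : H')

instance generatedIdeal_isTwoSided : (generatedIdeal J π ρ ξ ξ').IsTwoSided :=
  isTwoSided_closure _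

theorem isClosed_generatedIdeal :
    IsClosed (generatedIdeal J π ρ ξ ξ' : Set (toeplitzAlgebra π ρ ξ ξ')) :=
  isClosed_closure

theorem toeplitzHom_mem_generatedIdeal {a : A} (ha : a ∈ J) :
    toeplitzHom π ρ ξ ξ' (a, 0) ∈ generatedIdeal J π ρ ξ ξ' :=
  subset_closure (TwoSidedIdeal.subset_span ⟨a, ha, rfl⟩)

theorem map_eq_zero_of_mem_generatedIdeal {D : Type*} [CStarAlgebra D]
    (φ : toeplitzAlgebra π ρ ξ ξ' →⋆ₐ[ℂ] D)
    (h : ∀ a ∈ J, φ (toeplitzHom π ρ ξ ξ' (a, 0)) = 0) {T : toeplitzAlgebra π ρ ξ ξ'}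
    (hT : T ∈ generatedIdeal J π ρ ξ ξ') : φ T = 0 := by
  refine closure_minimal (t := {T | φ T = 0}) (fun T hT => ?_)
    (isClosed_singleton.preimage (starAlgHom_continuous φ)) hT
  have hle : TwoSidedIdeal.span {T : toeplitzAlgebra π ρ ξ ξ' |
      ∃ a ∈ J, (T : Fock H H' →L[ℂ] Fock H H') = fockRep π ρ (a, 0)} ≤
      TwoSidedIdeal.ker φ := by
    refine TwoSidedIdeal.span_le.mpr ?_
    rintro T ⟨a, ha, hTa⟩
    rw [SetLike.mem_coe, TwoSidedIdeal.mem_ker, ← h a ha]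
    exact congrArg φ (Subtype.ext hTa)
  exact (TwoSidedIdeal.mem_ker φ).mp (hle hT)

end Ideal

variable {A₁ A₂ : Type*} [CStarAlgebra A₁] [CStarAlgebra A₂]
  {J : Ideal A₁} [J.IsTwoSided] [Fact (IsClosed (J : Set A₁))]
  {H₁₀ H₁₁ H₂ : Type u}
  [NormedAddCommGroup H₁₀] [InnerProductSpace ℂ H₁₀] [CompleteSpace H₁₀]
  [NormedAddCommGroup H₁₁] [InnerProductSpace ℂ H₁₁] [CompleteSpace H₁₁]
  [NormedAddCommGroup H₂] [InnerProductSpace ℂ H₂] [CompleteSpace H₂]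
  (π₁₀ : A₁ ⧸ J →⋆ₐ[ℂ] (H₁₀ →L[ℂ] H₁₀)) (π₁₁ : A₁ →⋆ₐ[ℂ] (H₁₁ →L[ℂ] H₁₁))
  (π₂ : A₂ →⋆ₐ[ℂ] (H₂ →L[ℂ] H₂)) (ξ₁ : H₁₀) (ξ₂ : H₂)

theorem directSumRep_inclFst (a : A₁) (x : H₁₀) :
    directSumRep (π₁₀.comp (quotientMap J)) π₁₁ a (inclFst H₁₀ H₁₁ x) =
      inclFst H₁₀ H₁₁ (π₁₀ (quotientMap J a) x) :=
  WithLp.ofLp_injective 2 (Prod.ext rfl (map_zero (π₁₁ a)))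

theorem fockRep_compression (a : A₁ × A₂) (x : Fock H₁₀ H₂) :
    fockRep (directSumRep (π₁₀.comp (quotientMap J)) π₁₁) π₂ a
        (fockIsometry (inclFst H₁₀ H₁₁) LinearIsometry.id x) =
      fockIsometry (inclFst H₁₀ H₁₁) LinearIsometry.id
        (fockRep π₁₀ π₂ (quotientMap J a.1, a.2) x) :=
  fockRep_fockIsometry (a := (quotientMap J a.1, a.2)) _ _
    (fun x => directSumRep_inclFst π₁₀ π₁₁ a.1 x) (fun _ => rfl) x

theorem compression_toeplitz {T : Fock (WithLp 2 (H₁₀ × H₁₁)) H₂ →L[ℂ]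
      Fock (WithLp 2 (H₁₀ × H₁₁)) H₂}
    (hT : T ∈ toeplitzAlgebra (directSumRep (π₁₀.comp (quotientMap J)) π₁₁) π₂
      (inclFst H₁₀ H₁₁ ξ₁) ξ₂) :
    compression (fockIsometry (inclFst H₁₀ H₁₁) LinearIsometry.id) T ∈
        toeplitzAlgebra π₁₀ π₂ ξ₁ ξ₂ ∧
      ∀ x, T (fockIsometry (inclFst H₁₀ H₁₁) LinearIsometry.id x) =
        fockIsometry (inclFst H₁₀ H₁₁) LinearIsometry.id
          (compression (fockIsometry (inclFst H₁₀ H₁₁) LinearIsometry.id) T x) := by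
  refine compression_mem_of_mem_closure _ _ (isClosed_toeplitzAlgebra π₁₀ π₂ ξ₁ ξ₂) ?_ hT
  rintro _ (⟨a, rfl⟩ | rfl)
  · refine ⟨_, fockRep_mem π₁₀ π₂ ξ₁ ξ₂ (quotientMap J a.1, a.2),
      fockRep_compression π₁₀ π₁₁ π₂ a, fun x => ?_⟩
    rw [← fockRep_star, ← fockRep_star, fockRep_compression]
    rfl
  · exact ⟨_, shift_mem π₁₀ π₂ ξ₁ ξ₂,
      shift_fockIsometry (inclFst H₁₀ H₁₁) LinearIsometry.id ξ₁ ξ₂,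
      star_shift_fockIsometry (inclFst H₁₀ H₁₁) LinearIsometry.id ξ₁ ξ₂⟩

/-- The compression to the Fock space of `H₁₀` and `H₂`, as a *-homomorphism. -/
noncomputable def toeplitzQuotient :
    toeplitzAlgebra (directSumRep (π₁₀.comp (quotientMap J)) π₁₁) π₂ (inclFst H₁₀ H₁₁ ξ₁) ξ₂
      →⋆ₐ[ℂ] toeplitzAlgebra π₁₀ π₂ ξ₁ ξ₂ where
  toFun T := ⟨compression (fockIsometry (inclFst H₁₀ H₁₁) LinearIsometry.id) T,
    (compression_toeplitz π₁₀ π₁₁ π₂ ξ₁ ξ₂ T.2).1⟩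
  map_one' := Subtype.ext (compression_eq fun _ => rfl)
  map_mul' _ T' := Subtype.ext
    (compression_mul _ (compression_toeplitz π₁₀ π₁₁ π₂ ξ₁ ξ₂ T'.2).2)
  map_zero' := Subtype.ext (compression_eq fun _ => (map_zero _).symm)
  map_add' _ _ := Subtype.ext (compression_add _ _ _)
  commutes' r := Subtype.ext (compression_algebraMap _ r)
  map_star' _ := Subtype.ext (compression_star _ _)

theorem coe_toeplitzQuotient
    (T : toeplitzAlgebra (directSumRep (π₁₀.comp (quotientMap J)) π₁₁) π₂
      (inclFst H₁₀ H₁₁ ξ₁) ξ₂) :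
    (toeplitzQuotient π₁₀ π₁₁ π₂ ξ₁ ξ₂ T : Fock H₁₀ H₂ →L[ℂ] Fock H₁₀ H₂) =
      compression (fockIsometry (inclFst H₁₀ H₁₁) LinearIsometry.id) T := rfl

theorem toeplitzQuotient_toeplitzHom (a : A₁ × A₂) :
    toeplitzQuotient π₁₀ π₁₁ π₂ ξ₁ ξ₂ (toeplitzHom _ _ _ _ a) =
      toeplitzHom π₁₀ π₂ ξ₁ ξ₂ (quotientMap J a.1, a.2) :=
  Subtype.ext (compression_eq (fockRep_compression π₁₀ π₁₁ π₂ a))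

theorem toeplitzQuotient_toeplitzShift :
    toeplitzQuotient π₁₀ π₁₁ π₂ ξ₁ ξ₂ (toeplitzShift _ _ _ _) = toeplitzShift π₁₀ π₂ ξ₁ ξ₂ :=
  Subtype.ext (compression_eq
    (shift_fockIsometry (inclFst H₁₀ H₁₁) LinearIsometry.id ξ₁ ξ₂))

/-- The range contains the generators, since `A₁ → A₁ ⧸ J` is onto, so it is dense; it is also
closed. -/
theorem toeplitzQuotient_surjective :
    Function.Surjective (toeplitzQuotient π₁₀ π₁₁ π₂ ξ₁ ξ₂) := by
  refine surjective_of_denseRange _ fun x => ?_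
  refine closure_mono ?_ (mem_closure_adjoin_toeplitz π₁₀ π₂ ξ₁ ξ₂ x)
  have h : StarAlgebra.adjoin ℂ
      (Set.range (toeplitzHom π₁₀ π₂ ξ₁ ξ₂) ∪ {toeplitzShift π₁₀ π₂ ξ₁ ξ₂}) ≤
      (toeplitzQuotient π₁₀ π₁₁ π₂ ξ₁ ξ₂).range := by
    refine StarAlgebra.adjoin_le ?_
    rintro _ (⟨⟨b, a₂⟩, rfl⟩ | rfl)
    · obtain ⟨a₁, rfl⟩ := Ideal.Quotient.mk_surjective b
      exact ⟨_, toeplitzQuotient_toeplitzHom π₁₀ π₁₁ π₂ ξ₁ ξ₂ (a₁, a₂)⟩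
    · exact ⟨_, toeplitzQuotient_toeplitzShift π₁₀ π₁₁ π₂ ξ₁ ξ₂⟩
  exact h

theorem toeplitzQuotient_eq_zero_of_mem
    {T : toeplitzAlgebra (directSumRep (π₁₀.comp (quotientMap J)) π₁₁) π₂
      (inclFst H₁₀ H₁₁ ξ₁) ξ₂}
    (hT : T ∈ generatedIdeal J (directSumRep (π₁₀.comp (quotientMap J)) π₁₁) π₂
      (inclFst H₁₀ H₁₁ ξ₁) ξ₂) : toeplitzQuotient π₁₀ π₁₁ π₂ ξ₁ ξ₂ T = 0 := by
  refine map_eq_zero_of_mem_generatedIdeal _ _ _ _ _ _ (fun a ha => ?_) hT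
  have : (quotientMap J a, (0 : A₂)) = 0 := Prod.ext (Ideal.Quotient.eq_zero_iff_mem.mpr ha) rfl
  rw [toeplitzQuotient_toeplitzHom, this, map_zero]

theorem toeplitzQuotient_toeplitzGauge_eq_zero (z : Circle)
    (T : toeplitzAlgebra (directSumRep (π₁₀.comp (quotientMap J)) π₁₁) π₂
      (inclFst H₁₀ H₁₁ ξ₁) ξ₂) (hT : toeplitzQuotient π₁₀ π₁₁ π₂ ξ₁ ξ₂ T = 0) :
    toeplitzQuotient π₁₀ π₁₁ π₂ ξ₁ ξ₂ (toeplitzGauge _ _ _ _ z T) = 0 := by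
  refine Subtype.ext ?_
  rw [coe_toeplitzQuotient, coe_toeplitzGauge, compression_gaugeHom, ← coe_toeplitzQuotient, hT]
  exact map_zero _

/-- Faithful representations are isometric, and both product norms are suprema. With `π₁` and `π₂`
this provides the isometric `ε` on `K`. -/
theorem norm_toeplitzFirstLevel_toeplitzHom {A B : Type*} [CStarAlgebra A] [CStarAlgebra B]
    {H H' : Type u}
    [NormedAddCommGroup H] [InnerProductSpace ℂ H] [CompleteSpace H]
    [NormedAddCommGroup H'] [InnerProductSpace ℂ H'] [CompleteSpace H']
    {π : A →⋆ₐ[ℂ] (H →L[ℂ] H)} {ρ : B →⋆ₐ[ℂ] (H' →L[ℂ] H')} (hπ : Function.Injective π)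
    (hρ : Function.Injective ρ) (ξ : H) (ξ' : H') (a : A × B) :
    ‖toeplitzFirstLevel π ρ ξ ξ' (toeplitzHom π ρ ξ ξ' a)‖ = ‖a‖ := by
  rw [toeplitzFirstLevel_toeplitzHom, Prod.norm_def, Prod.norm_def,
    NonUnitalStarAlgHom.norm_map π hπ, NonUnitalStarAlgHom.norm_map ρ hρ]

/-- On words of length one in `K₀` the coefficient acts as `π₁₀ [a₁]` and `π₂ a₂`. Faithfulness of
both forces `a₁ ∈ J` and `a₂ = 0`. -/
theorem toeplitzHom_mem_generatedIdeal_of_firstLevel (hπ₁₀ : Function.Injective π₁₀)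
    (hπ₂ : Function.Injective π₂) (a : A₁ × A₂)
    (ha : toeplitzFirstLevel π₁₀ π₂ ξ₁ ξ₂ (toeplitzHom π₁₀ π₂ ξ₁ ξ₂ (quotientMap J a.1, a.2)) = 0) :
    toeplitzHom (directSumRep (π₁₀.comp (quotientMap J)) π₁₁) π₂ (inclFst H₁₀ H₁₁ ξ₁) ξ₂ a ∈
      generatedIdeal J (directSumRep (π₁₀.comp (quotientMap J)) π₁₁) π₂
        (inclFst H₁₀ H₁₁ ξ₁) ξ₂ := by
  obtain ⟨a₁, a₂⟩ := a
  rw [toeplitzFirstLevel_toeplitzHom, Prod.mk_eq_zero, map_eq_zero_iff π₁₀ hπ₁₀,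
    map_eq_zero_iff π₂ hπ₂] at ha
  obtain ⟨h1, rfl⟩ := ha
  have h2 : a₁ ∈ J := Ideal.Quotient.eq_zero_iff_mem.mp h1
  exact toeplitzHom_mem_generatedIdeal J (directSumRep (π₁₀.comp (quotientMap J)) π₁₁) π₂
    (inclFst H₁₀ H₁₁ ξ₁) ξ₂ h2

theorem mem_of_toeplitzQuotient_eq_zero (hπ₁₀ : Function.Injective π₁₀)
    (hπ₂ : Function.Injective π₂)
    (hπ₁ : Function.Injective (directSumRep (π₁₀.comp (quotientMap J)) π₁₁))
    {T : toeplitzAlgebra (directSumRep (π₁₀.comp (quotientMap J)) π₁₁) π₂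
      (inclFst H₁₀ H₁₁ ξ₁) ξ₂} (hT : toeplitzQuotient π₁₀ π₁₁ π₂ ξ₁ ξ₂ T = 0) :
    T ∈ generatedIdeal J (directSumRep (π₁₀.comp (quotientMap J)) π₁₁) π₂
      (inclFst H₁₀ H₁₁ ξ₁) ξ₂ := by
  let π₁ := directSumRep (π₁₀.comp (quotientMap J)) π₁₁
  let η := inclFst H₁₀ H₁₁ ξ₁
  -- The coefficient algebra is `A₁ × A₂`; `ε` and `ε₀` are the compressions to words of length one
  -- in `K` and in `K₀`.
  refine mem_of_map_eq_zero
    (fun a => ⟨_, star_toeplitzShift_mul_toeplitzHom_mul_toeplitzShift π₁ π₂ η ξ₂ a⟩)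
    (mem_closure_adjoin_toeplitz π₁ π₂ η ξ₂) (toeplitzGauge_toeplitzHom π₁ π₂ η ξ₂)
    (toeplitzGauge_toeplitzShift π₁ π₂ η ξ₂) (toeplitzGauge_mul π₁ π₂ η ξ₂)
    (toeplitzGauge_one π₁ π₂ η ξ₂) (toeplitzQuotient π₁₀ π₁₁ π₂ ξ₁ ξ₂)
    (toeplitzQuotient_toeplitzGauge_eq_zero π₁₀ π₁₁ π₂ ξ₁ ξ₂)
    (isClosed_generatedIdeal J π₁ π₂ η ξ₂)
    (fun T hT => toeplitzQuotient_eq_zero_of_mem π₁₀ π₁₁ π₂ ξ₁ ξ₂ hT)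
    (toeplitzFirstLevel_mul_toeplitzShift_mul π₁ π₂ η ξ₂)
    (norm_toeplitzFirstLevel_toeplitzHom hπ₁ hπ₂ η ξ₂)
    (toeplitzQuotient_toeplitzHom π₁₀ π₁₁ π₂ ξ₁ ξ₂)
    (toeplitzQuotient_toeplitzShift π₁₀ π₁₁ π₂ ξ₁ ξ₂)
    (fun a => toeplitzFirstLevel_mul_toeplitzShift_mul π₁₀ π₂ ξ₁ ξ₂ _)
    (toeplitzHom_mem_generatedIdeal_of_firstLevel π₁₀ π₁₁ π₂ ξ₁ ξ₂ hπ₁₀ hπ₂) hT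

end Main
end ToeplitzPimsner

theorem mainTheorem3 {A₁ A₂ : Type*} [CStarAlgebra A₁] [CStarAlgebra A₂]
    (J : Ideal A₁) [J.IsTwoSided] [Fact (IsClosed (J : Set A₁))]
    {H₁₀ H₁₁ H₂ : Type u}
    [NormedAddCommGroup H₁₀] [InnerProductSpace ℂ H₁₀] [CompleteSpace H₁₀]
    [NormedAddCommGroup H₁₁] [InnerProductSpace ℂ H₁₁] [CompleteSpace H₁₁]
    [NormedAddCommGroup H₂] [InnerProductSpace ℂ H₂] [CompleteSpace H₂]
    (π₁₀ : A₁ ⧸ J →⋆ₐ[ℂ] (H₁₀ →L[ℂ] H₁₀)) (π₁₁ : A₁ →⋆ₐ[ℂ] (H₁₁ →L[ℂ] H₁₁))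
    (π₂ : A₂ →⋆ₐ[ℂ] (H₂ →L[ℂ] H₂))
    (π₁ : A₁ →⋆ₐ[ℂ] (WithLp 2 (H₁₀ × H₁₁) →L[ℂ] WithLp 2 (H₁₀ × H₁₁)))
    (hπ₁ : π₁ = directSumRep (π₁₀.comp (quotientMap J)) π₁₁)
    (hπ₁₀_faithful : Function.Injective π₁₀) (hπ₂_faithful : Function.Injective π₂)
    (hπ₁_faithful : Function.Injective π₁)
    (ξ₁ : H₁₀) (ξ₂ : H₂) (hξ₁ : ‖ξ₁‖ = 1) (hξ₂ : ‖ξ₂‖ = 1) :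
    ∃ π' : toeplitzAlgebra π₁ π₂ (inclFst H₁₀ H₁₁ ξ₁) ξ₂ →⋆ₐ[ℂ] toeplitzAlgebra π₁₀ π₂ ξ₁ ξ₂,
      (∀ T, (π' T : Fock H₁₀ H₂ →L[ℂ] Fock H₁₀ H₂) =
        compression (fockIsometry (inclFst H₁₀ H₁₁) LinearIsometry.id) T) ∧
      Function.Injective (generatedIdeal J π₁ π₂ (inclFst H₁₀ H₁₁ ξ₁) ξ₂).subtype ∧
      Function.Exact (generatedIdeal J π₁ π₂ (inclFst H₁₀ H₁₁ ξ₁) ξ₂).subtype π' ∧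
      Function.Surjective π' := by

  subst hπ₁
  refine ⟨toeplitzQuotient π₁₀ π₁₁ π₂ ξ₁ ξ₂, coe_toeplitzQuotient π₁₀ π₁₁ π₂ ξ₁ ξ₂,
    Subtype.val_injective, fun T => ⟨fun hT => ?_, ?_⟩,
    toeplitzQuotient_surjective π₁₀ π₁₁ π₂ ξ₁ ξ₂⟩
  · exact ⟨⟨T, mem_of_toeplitzQuotient_eq_zero π₁₀ π₁₁ π₂ ξ₁ ξ₂ hπ₁₀_faithful hπ₂_faithful
      hπ₁_faithful hT⟩, rfl⟩
  · rintro ⟨T, rfl⟩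
    exact toeplitzQuotient_eq_zero_of_mem π₁₀ π₁₁ π₂ ξ₁ ξ₂ T.2
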